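/- Let $k$ be an algebraically closed field of characteristic zero and $X$ a normal variety over $k$, i.e. a normal, integral, separated scheme of finite type over $k$, with generic point $\eta$ and function field $K=\mathcal O_{X,\eta}$. Let $\operatorname{Div}(X)$ be the free abelian group on the prime divisors of $X$, ordered coefficientwise, with coefficientwise minimum $\wedge$, and adjoin a largest element $\infty$ with $D+\infty=\infty+D=\infty$; put $\operatorname{div}(0)=\infty$. For an open set $U$, write $D|_U\ge 0$ if the coefficients of $D$ at all prime divisors meeting $U$ are non-negative (always true for $D=\infty$). A pre-Weil decoration on a finite-dimensional $K$-vector space $V$ is a map $\mathcal W\colon V\to\operatorname{Div}(X)\cup\{\infty\}$ such that for all $v,v'\in V$ and $f\in K$: $\mathcal W(v)=\infty$ if and only if $v=0$; $\mathcal W(fv)=\operatorname{div}(f)+\mathcal W(v)$; and $\mathcal W(v+v')\ge\mathcal W(v)\wedge\mathcal W(v')$. Its associated sheaf is the $\mathcal O_X$-submodule $\mathcal O_X(\mathcal W)$ of the constant sheaf $V$ with $\mathcal O_X(\mathcal W)(U)=\{v\in V: \mathcal W(v)|_U\ge 0\}$ for nonempty open $U$. A Weil decoration is a pre-Weil decoration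 for which $\mathcal O_X(\mathcal W)$ is coherent. A morphism from a Weil decoration $\mathcal W$ on $V$ to a Weil decoration $\mathcal W'$ on $V'$ is a $K$-linear map $\mu\colon V\to V'$ with $\mathcal W(v)\le\mathcal W'(\mu(v))$ for all $v\in V$. A coherent sheaf on $X$ is reflexive if its canonical map into its double dual is an isomorphism; morphisms of reflexive sheaves are the $\mathcal O_X$-linear maps. (1) If $\mathcal E$ is a reflexive sheaf, then $\mathcal E_\eta$ is finite-dimensional over $K$, the maps $\mathcal E(U)\to\mathcal E_\eta$ are injective for all nonempty open $U$, and for every $0\ne e\in\mathcal E_\eta$ there is exactly one $D\in\operatorname{Div}(X)$ such that for all nonempty open $U$ and all $f\in K$ one has $fe\in\mathcal E(U)$ if and only if $(\operatorname{div}(f)+D)|_U\ge 0$. Putting $\mathcal W_{\mathcal E}(e)=D$ and $\mathcal W_{\mathcal E}(0)=\infty$ defines a Weil decoration $\mathcal W_{\mathcal E}$ on $\mathcal E_\eta$, and $\mathcal O_X(\mathcal W_{\mathcal E})=\mathcal E$ inside the constant sheaf $\mathcal E_\eta$. (2) For every finite-dimensional $K$-vector space $V$, the maps $\mathcal W\mapsto\mathcal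 O_X(\mathcal W)$ and $\mathcal E\mapsto\mathcal W_{\mathcal E}$ are well-defined mutually inverse bijections between the Weil decorations on $V$ and the reflexive $\mathcal O_X$-submodule sheaves $\mathcal E$ of the constant sheaf $V$ with generic stalk $\mathcal E_\eta=V$. (3) The assignments $\mathcal W\mapsto\mathcal O_X(\mathcal W)$ (on morphisms: the restriction of $\mu$ to sections) and $\mathcal E\mapsto\mathcal W_{\mathcal E}$, $\varphi\mapsto\varphi_\eta$, are well-defined functors between the category of Weil decorations on $X$ and the category of reflexive sheaves on $X$, and they are mutually quasi-inverse equivalences of categories. -/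

import Mathlib

open CategoryTheory AlgebraicGeometry TopologicalSpace Opposite

universe u

noncomputable section

/-! ### Duals of presheaves of modules -/

namespace DualModule

variable {T : TopCat.{u}} {R : T.Presheaf CommRingCat.{u}}
  (M N : PresheafOfModules.{u} (R ⋙ forget₂ CommRingCat RingCat))

/-- Sections over `U` of `ℋom(M, R)`: families of `R(V)`-linear maps `M(V) → R(V)`, for `V ⊆ U`,
compatible with restriction, i.e. morphisms of presheaves of modules `M|_U → R|_U`. -/
def dualSections (U : Opens T) :
    AddSubgroup (∀ V : {V : Opens T // V ≤ U},
      M.obj (op V.1) →ₗ[R.obj (op V.1)] R.obj (op V.1)) where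
  carrier := {φ | ∀ (V W : {V : Opens T // V ≤ U}) (h : W.1 ≤ V.1) (m : M.obj (op V.1)),
    R.map (homOfLE h).op (φ V m) = φ W (M.map (homOfLE h).op m)}
  zero_mem' := fun _ _ h _ ↦ map_zero (R.map (homOfLE h).op).hom
  add_mem' := fun {a b} ha hb V W h m ↦
    (map_add (R.map (homOfLE h).op).hom (a V m) (b V m)).trans
      (congrArg₂ (· + ·) (ha V W h m) (hb V W h m))
  neg_mem' := fun {a} ha V W h m ↦
    (map_neg (R.map (homOfLE h).op).hom (a V m)).trans (congrArg (- ·) (ha V W h m))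

variable {M N}

/-- The value of a section of the dual on a section of `M`. -/
def dualEval {U : Opens T} (φ : dualSections M U) (V : Opens T) (h : V ≤ U)
    (m : M.obj (op V)) : R.obj (op V) := φ.1 ⟨V, h⟩ m

lemma dualSections_ext {U : Opens T} {φ ψ : dualSections M U}
    (H : ∀ (V : Opens T) (h : V ≤ U) (m : M.obj (op V)), dualEval φ V h m = dualEval ψ V h m) :
    φ = ψ :=
  Subtype.ext (funext fun V ↦ LinearMap.ext fun m ↦ H V.1 V.2 m)

/-- A function on opens `V ⊆ U` and sections of `M` over `V` which is additive, homogeneous and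
compatible with restriction defines a section of the dual. -/
def dualMk {U : Opens T} (f : ∀ V : Opens T, V ≤ U → M.obj (op V) → R.obj (op V))
    (hadd : ∀ V h m n, f V h (m + n) = f V h m + f V h n)
    (hsmul : ∀ V h (r : R.obj (op V)) m, f V h (r • m) = r * f V h m)
    (hres : ∀ V W (hV : V ≤ U) (h : W ≤ V) m,
      R.map (homOfLE h).op (f V hV m) = f W (h.trans hV) (M.map (homOfLE h).op m)) :
    dualSections M U :=
  ⟨fun V ↦ { toFun := f V.1 V.2, map_add' := hadd V.1 V.2, map_smul' := hsmul V.1 V.2 },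
    fun V W h m ↦ hres V.1 W.1 V.2 h m⟩

lemma dualEval_add' {U : Opens T} (φ : dualSections M U) (V : Opens T) (h : V ≤ U)
    (m n : M.obj (op V)) : dualEval φ V h (m + n) = dualEval φ V h m + dualEval φ V h n :=
  map_add (φ.1 ⟨V, h⟩) m n

lemma dualEval_smul' {U : Opens T} (φ : dualSections M U) (V : Opens T) (h : V ≤ U)
    (r : R.obj (op V)) (m : M.obj (op V)) : dualEval φ V h (r • m) = r * dualEval φ V h m :=
  map_smul (φ.1 ⟨V, h⟩) r m

lemma dualEval_res {U : Opens T} (φ : dualSections M U) (V W : Opens T) (hV : V ≤ U) (h : W ≤ V)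
    (m : M.obj (op V)) :
    R.map (homOfLE h).op (dualEval φ V hV m) =
      dualEval φ W (h.trans hV) (M.map (homOfLE h).op m) :=
  φ.2 ⟨V, hV⟩ ⟨W, h.trans hV⟩ h m

instance (U : Opens T) : SMul (R.obj (op U)) (dualSections M U) where
  smul r φ := dualMk (fun V h m ↦ R.map (homOfLE h).op r * dualEval φ V h m)
    (fun V h m n ↦ by rw [dualEval_add', mul_add])
    (fun V h s m ↦ by rw [dualEval_smul', mul_left_comm])
    (fun V W hV h m ↦ by
      rw [map_mul, dualEval_res, ← ConcreteCategory.comp_apply, ← R.map_comp]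
      rfl)

lemma dualEval_smul {U : Opens T} (r : R.obj (op U)) (φ : dualSections M U) (V : Opens T)
    (h : V ≤ U) (m : M.obj (op V)) :
    dualEval (r • φ) V h m = R.map (homOfLE h).op r * dualEval φ V h m := rfl

lemma dualEval_add {U : Opens T} (φ ψ : dualSections M U) (V : Opens T)
    (h : V ≤ U) (m : M.obj (op V)) :
    dualEval (φ + ψ) V h m = dualEval φ V h m + dualEval ψ V h m := rfl

lemma dualEval_zero {U : Opens T} (V : Opens T) (h : V ≤ U) (m : M.obj (op V)) :
    dualEval (0 : dualSections M U) V h m = 0 := rfl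

/-- `R(U)` acts on `ℋom(M, R)(U)` through the values. -/
instance (U : Opens T) : Module (R.obj (op U)) (dualSections M U) where
  one_smul φ := dualSections_ext fun V h m ↦ by rw [dualEval_smul, map_one, one_mul]
  mul_smul r s φ := dualSections_ext fun V h m ↦ by
    rw [dualEval_smul, dualEval_smul, dualEval_smul, map_mul, mul_assoc]
  smul_zero r := dualSections_ext fun V h m ↦ by
    rw [dualEval_smul, dualEval_zero, mul_zero]
  smul_add r φ ψ := dualSections_ext fun V h m ↦ by
    simp only [dualEval_smul, dualEval_add, mul_add]
  add_smul r s φ := dualSections_ext fun V h m ↦ by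
    simp only [dualEval_smul, dualEval_add, map_add, add_mul]
  zero_smul φ := dualSections_ext fun V h m ↦ by
    rw [dualEval_smul, map_zero, zero_mul, dualEval_zero]

/-- Restriction of sections of the dual. -/
def dualRes {U U' : Opens T} (i : U' ≤ U) : dualSections M U →+ dualSections M U' where
  toFun φ := ⟨fun V ↦ φ.1 ⟨V.1, V.2.trans i⟩, fun V W h m ↦
    φ.2 ⟨V.1, V.2.trans i⟩ ⟨W.1, W.2.trans i⟩ h m⟩
  map_zero' := rfl
  map_add' _ _ := rfl

lemma dualEval_dualRes {U U' : Opens T} (i : U' ≤ U) (φ : dualSections M U) (V : Opens T)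
    (h : V ≤ U') (m : M.obj (op V)) :
    dualEval (dualRes i φ) V h m = dualEval φ V (h.trans i) m := rfl

variable (M)

/-- The underlying presheaf of abelian groups of the dual. -/
def dualAb : (Opens T)ᵒᵖ ⥤ Ab.{u} where
  obj U := AddCommGrpCat.of (dualSections M U.unop)
  map f := AddCommGrpCat.ofHom (dualRes (leOfHom f.unop))

instance (U : (Opens T)ᵒᵖ) :
    Module ((R ⋙ forget₂ CommRingCat RingCat).obj U) ((dualAb M).obj U) :=
  inferInstanceAs (Module (R.obj (op U.unop)) (dualSections M U.unop))

/-- The dual `M^∨ = ℋom(M, R)`. When `R` is a sheaf, this is a sheaf as well. -/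
def dual : PresheafOfModules.{u} (R ⋙ forget₂ CommRingCat RingCat) :=
  PresheafOfModules.ofPresheaf (dualAb M) fun U U' f r φ ↦
    dualSections_ext (M := M) (U := U'.unop) fun V h m ↦ by
      change R.map (homOfLE _).op r * _ = R.map (homOfLE h).op (R.map f r) * _
      rw [← ConcreteCategory.comp_apply, ← R.map_comp]
      rfl

variable {M}

/-- Evaluation at a section `m` of `M` over `U`, as a section of the bidual over `U`. -/
def evalAt {U : Opens T} (m : M.obj (op U)) : dualSections (dual M) U :=
  dualMk (fun V h (φ : dualSections M V) ↦ dualEval φ V le_rfl (M.map (homOfLE h).op m))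
    (fun _ _ _ _ ↦ rfl)
    (fun V h r φ ↦ by
      refine (dualEval_smul r φ V le_rfl _).trans ?_
      congr 1
      exact CategoryTheory.congr_fun (R.map_id (op V)) r)
    (fun V W hV h φ ↦ by
      refine (dualEval_res φ V W le_rfl h _).trans ?_
      rw [← PresheafOfModules.map_comp_apply]
      rfl)

lemma dualEval_evalAt {U : Opens T} (m : M.obj (op U)) (V : Opens T) (h : V ≤ U)
    (φ : dualSections M V) :
    dualEval (M := dual M) (evalAt m) V h φ = dualEval φ V le_rfl (M.map (homOfLE h).op m) := rfl

variable (M)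

/-- The canonical map `M → M^∨∨`, `m ↦ (φ ↦ φ(m))`. -/
def toBidual : M ⟶ dual (dual M) :=
  PresheafOfModules.homMk
    { app := fun U ↦ AddCommGrpCat.ofHom (AddMonoidHom.mk' (fun m : M.obj (op U.unop) ↦ evalAt m)
        fun m n ↦ dualSections_ext fun V h (φ : dualSections M V) ↦ by
          exact (congrArg (dualEval φ V le_rfl) (map_add (M.map (homOfLE h).op).hom m n)).trans
            (dualEval_add' φ V le_rfl _ _))
      naturality := fun U U' f ↦ by
        ext m
        refine dualSections_ext (M := dual M) (U := U'.unop) fun V h (φ : dualSections M V) ↦ ?_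
        exact congrArg (dualEval φ V le_rfl) (M.map_comp_apply f (homOfLE h).op m).symm }
    fun U r m ↦ dualSections_ext (M := dual M) (U := U.unop) fun V h (φ : dualSections M V) ↦ by
      change dualEval φ V le_rfl (M.map (homOfLE h).op (r • m)) =
        R.map (homOfLE h).op r * dualEval φ V le_rfl (M.map (homOfLE h).op m)
      refine Eq.trans ?_ (dualEval_smul' φ V le_rfl _ _)
      congr 1
      exact M.map_smul _ _ _

end DualModule

namespace WeilDecorations

/-! ### Normal varieties -/

/-- A normal variety over `k`: a normal, integral and separated scheme of finite type over `k`. -/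
structure NormalVariety (k : Type u) [Field k] where
  toScheme : Scheme.{u}
  structureMap : toScheme ⟶ Spec (.of k)
  isIntegral : IsIntegral toScheme
  isSeparated : IsSeparated structureMap
  locallyOfFiniteType : LocallyOfFiniteType structureMap
  quasiCompact : QuasiCompact structureMap
  isIntegrallyClosed : ∀ x : toScheme, IsIntegrallyClosed (toScheme.presheaf.stalk x)

attribute [instance] NormalVariety.isIntegral NormalVariety.isSeparated
  NormalVariety.locallyOfFiniteType NormalVariety.quasiCompact NormalVariety.isIntegrallyClosed

instance {k : Type u} [Field k] (X : NormalVariety k) : IsNoetherian X.toScheme :=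
  { LocallyOfFiniteType.isLocallyNoetherian X.structureMap,
    QuasiCompact.compactSpace_of_compactSpace X.structureMap with }

/-! ### Weil divisors -/

section Divisors

variable (X : Scheme.{u})

/-- Prime divisors, represented by their generic points: the points of codimension one. -/
abbrev PrimeDivisor : Type u := {P : X // Order.coheight P = 1}

/-- The group of Weil divisors, with its coefficientwise order (so `⊓` is the coefficientwise
minimum). -/
abbrev WeilDivisor : Type u := PrimeDivisor X →₀ ℤ

variable {X}

/-- The coefficient of a divisor, or of the formal symbol `∞ = ⊤`, at a prime divisor. -/
def coeffAt (P : PrimeDivisor X) : WithTop (WeilDivisor X) → WithTop ℤ :=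
  WithTop.map fun D ↦ D P

/-- `D|_U ≥ 0`. -/
def EffectiveOn (D : WithTop (WeilDivisor X)) (U : X.Opens) : Prop :=
  ∀ P : PrimeDivisor X, P.1 ∈ U → 0 ≤ coeffAt P D

lemma EffectiveOn.add {D D' : WithTop (WeilDivisor X)} {U : X.Opens} (h : EffectiveOn D U)
    (h' : EffectiveOn D' U) : EffectiveOn (D + D') U := by
  intro P hP
  have h := h P hP
  have h' := h' P hP
  induction D with
  | top => exact le_top
  | coe D =>
    induction D' with
    | top => exact le_top
    | coe D' =>
      exact WithTop.coe_le_coe.mpr (add_nonneg (WithTop.coe_le_coe.mp h) (WithTop.coe_le_coe.mp h'))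

lemma EffectiveOn.of_inf_le {D D' D'' : WithTop (WeilDivisor X)} {U : X.Opens} (h : EffectiveOn D U)
    (h' : EffectiveOn D' U) (hle : D ⊓ D' ≤ D'') : EffectiveOn D'' U := by
  intro P hP
  have h := h P hP
  have h' := h' P hP
  have mono : ∀ {A B : WithTop (WeilDivisor X)}, A ≤ B → coeffAt P A ≤ coeffAt P B := fun hAB ↦
    (show Monotone fun D : WeilDivisor X ↦ D P from fun _ _ hD ↦ hD P).withTop_map hAB
  refine le_trans ?_ (mono hle)
  induction D with
  | top => rwa [top_inf_eq]
  | coe D =>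
    induction D' with
    | top => rwa [inf_top_eq]
    | coe D' =>
      exact WithTop.coe_le_coe.mpr (le_inf (WithTop.coe_le_coe.mp h) (WithTop.coe_le_coe.mp h'))

variable [IsIntegral X]

lemma genericPoint_mem_of_mem {U : X.Opens} {x : X} (hx : x ∈ U) : genericPoint X ∈ U :=
  (genericPoint_spec X).mem_open_set_iff U.isOpen |>.mpr ⟨x, trivial, hx⟩

variable [IsNoetherian X]

lemma finite_primeDivisor_not_mem (U : X.Opens) (hU : genericPoint X ∈ U) :
    {P : PrimeDivisor X | P.1 ∉ U}.Finite := by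
  obtain ⟨S, hS, hSc, hSi, hSU⟩ :=
    NoetherianSpace.exists_finite_set_isClosed_irreducible U.isOpen.isClosed_compl
  refine Set.Finite.of_finite_image (f := Subtype.val) ?_ Subtype.val_injective.injOn
  classical
  refine (hS.image fun t ↦ if h : IsIrreducible t then h.genericPoint else
    genericPoint X).subset ?_
  rintro _ ⟨P, hP, rfl⟩
  have hP' : P.1 ∈ (U : Set X)ᶜ := hP
  rw [hSU] at hP'
  obtain ⟨t, ht, hPt⟩ := hP'
  refine ⟨t, ht, ?_⟩
  have hti := hSi t ht
  simp only [hti, dif_pos]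
  have hQ : IsGenericPoint hti.genericPoint t := by
    have := hti.isGenericPoint_genericPoint_closure
    rwa [(hSc t ht).closure_eq] at this
  have hQU : hti.genericPoint ∉ U := by
    have : hti.genericPoint ∈ ⋃₀ S := ⟨t, ht, hQ.mem⟩
    rw [← hSU] at this
    exact this
  have h1 : P.1 ≤ hti.genericPoint := hQ.specializes hPt
  have h2 : hti.genericPoint ≤ genericPoint X := genericPoint_specializes _
  have h2' : hti.genericPoint < genericPoint X := by
    refine lt_of_le_not_ge h2 fun h ↦ hQU ?_
    exact h.mem_open U.isOpen hU
  by_contra hne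
  have h1' : P.1 < hti.genericPoint :=
    lt_of_le_not_ge h1 fun h ↦ hne (Specializes.antisymm h1 h).eq
  have e1 := Order.coheight_add_one_le h1'
  have e2 := Order.coheight_add_one_le h2'
  rw [P.2] at e1
  have h3 : (1 : ℕ∞) ≤ Order.coheight hti.genericPoint := le_trans (by simp) e2
  have := (add_le_add_left h3 1).trans e1
  norm_num at this

lemma finite_ord_ne_zero (f : X.functionField) :
    {P : PrimeDivisor X | Scheme.ord f P.1 ≠ 0}.Finite := by
  by_cases hf : f = 0
  · simp [hf]
  obtain ⟨U, -, f', hU, rfl, hu⟩ := exists_isUnit_germ_eq X f hf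
  refine (finite_primeDivisor_not_mem U (genericPoint_mem_of_mem hU.some.2)).subset fun P hP hPU ↦ hP ?_
  exact Scheme.ord_of_isUnit hu hPU

open Classical in
/-- The divisor of a rational function, with `div(0) = ∞`. -/
def div (f : X.functionField) : WithTop (WeilDivisor X) :=
  if f = 0 then ⊤
  else ((Finsupp.ofSupportFinite (fun P : PrimeDivisor X ↦ Scheme.ord f P.1)
    (finite_ord_ne_zero f) : WeilDivisor X) : WithTop (WeilDivisor X))

lemma effectiveOn_div_germ (U : X.Opens) (hU : genericPoint X ∈ U) (f : Γ(X, U)) :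
    EffectiveOn (div (X.presheaf.germ U _ hU f)) U := by
  intro P hP
  unfold div
  split_ifs with h
  · exact le_top
  · have : Nonempty U := ⟨⟨_, hP⟩⟩
    have hf : f ≠ 0 := by rintro rfl; simp at h
    have := Scheme.ord_le_smul hP hf (1 : X.functionField)
    rw [Algebra.smul_def, mul_one] at this
    refine WithTop.coe_le_coe.mpr (le_trans (le_of_eq ?_) this)
    have h1 := Scheme.ord_of_isUnit (X := X) (U := U) (f := 1) isUnit_one hP
    rw [map_one] at h1
    exact h1.symm

end Divisors

/-! ### Subsheaves of constant sheaves -/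

section Subsheaf

variable (X : Scheme.{u}) [IsIntegral X]
  (V V' : Type u) [AddCommGroup V] [Module X.functionField V]
  [AddCommGroup V'] [Module X.functionField V']

/-- An `𝒪_X`-submodule sheaf of the constant sheaf with value the `K(X)`-vector space `V`. On a
nonempty open set (equivalently, one which contains the generic point) its sections form a subgroup
of `V`, and restriction is inclusion. -/
@[ext]
structure ConstSubsheaf where
  sections : ∀ U : X.Opens, genericPoint X ∈ U → AddSubgroup V
  smul_mem : ∀ (U : X.Opens) (hU : genericPoint X ∈ U) (f : Γ(X, U)) (v : V),
    v ∈ sections U hU → X.presheaf.germ U _ hU f • v ∈ sections U hU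
  mono : ∀ (U U' : X.Opens) (hU : genericPoint X ∈ U) (hU' : genericPoint X ∈ U'),
    U' ≤ U → sections U hU ≤ sections U' hU'
  locality : ∀ (U : X.Opens) (hU : genericPoint X ∈ U) (v : V),
    (∀ x ∈ U, ∃ (U' : X.Opens) (hU' : genericPoint X ∈ U'), x ∈ U' ∧ U' ≤ U ∧
      v ∈ sections U' hU') → v ∈ sections U hU

namespace ConstSubsheaf

variable {X V V'}
variable (E : ConstSubsheaf X V) (E' : ConstSubsheaf X V')

/-- Sections of the sheaf over an arbitrary open set: an element of `E.sections U` if `U` is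
nonempty, and a unique section if `U` is empty. -/
def gamma (U : X.Opens) : AddSubgroup (PLift (genericPoint X ∈ U) → V) where
  carrier := {s | ∀ h, s h ∈ E.sections U h.down}
  zero_mem' _ := zero_mem _
  add_mem' ha hb h := add_mem (ha h) (hb h)
  neg_mem' ha h := neg_mem (ha h)

instance (U : X.Opens) : SMul Γ(X, U) (E.gamma U) where
  smul f s := ⟨fun h ↦ X.presheaf.germ U _ h.down f • s.1 h,
    fun h ↦ E.smul_mem U h.down f _ (s.2 h)⟩

lemma gamma_smul (U : X.Opens) (f : Γ(X, U)) (s : E.gamma U) (h : PLift (genericPoint X ∈ U)) :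
    (f • s).1 h = X.presheaf.germ U _ h.down f • s.1 h := rfl

instance (U : X.Opens) : Module Γ(X, U) (E.gamma U) where
  one_smul s := Subtype.ext (funext fun h ↦ by rw [gamma_smul, map_one, one_smul])
  mul_smul r t s := Subtype.ext (funext fun h ↦ by
    rw [gamma_smul, gamma_smul, gamma_smul, map_mul, mul_smul])
  smul_zero r := Subtype.ext (funext fun h ↦ smul_zero _)
  smul_add r s t := Subtype.ext (funext fun h ↦ smul_add _ _ _)
  add_smul r t s := Subtype.ext (funext fun h ↦ by
    rw [gamma_smul, map_add, add_smul]; rfl)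
  zero_smul s := Subtype.ext (funext fun h ↦ by rw [gamma_smul, map_zero, zero_smul]; rfl)

/-- The restriction maps, which are inclusions. -/
def res {U U' : X.Opens} (i : U' ≤ U) : E.gamma U →+ E.gamma U' where
  toFun s := ⟨fun h ↦ s.1 ⟨i h.down⟩, fun h ↦ E.mono U U' (i h.down) h.down i (s.2 _)⟩
  map_zero' := rfl
  map_add' _ _ := rfl

/-- The underlying presheaf of abelian groups. -/
def toAb : X.Opensᵒᵖ ⥤ Ab.{u} where
  obj U := AddCommGrpCat.of (E.gamma U.unop)
  map f := AddCommGrpCat.ofHom (E.res (leOfHom f.unop))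

instance (U : X.Opensᵒᵖ) : Module (X.ringCatSheaf.obj.obj U) (E.toAb.obj U) :=
  inferInstanceAs (Module Γ(X, U.unop) (E.gamma U.unop))

/-- The underlying presheaf of modules. -/
def toPresheafOfModules : X.PresheafOfModules :=
  PresheafOfModules.ofPresheaf E.toAb fun U U' f (r : Γ(X, U.unop)) (s : E.gamma U.unop) ↦
    Subtype.ext (funext fun (h : PLift (genericPoint X ∈ U'.unop)) ↦
      congrArg (· • s.1 ⟨leOfHom f.unop h.down⟩)
        (X.presheaf.germ_res_apply' f (genericPoint X) h.down r).symm)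

lemma isSheaf_toAb : TopCat.Presheaf.IsSheaf (X := X.carrier) E.toAb := by
  rw [TopCat.Presheaf.isSheaf_iff_isSheafUniqueGluing]
  intro ι U sf hsf
  have key : ∀ i j (hi : genericPoint X ∈ U i) (hj : genericPoint X ∈ U j),
      (sf i).1 ⟨hi⟩ = (sf j).1 ⟨hj⟩ := fun i j hi hj ↦
    congrFun (congrArg Subtype.val (hsf i j)) ⟨⟨hi, hj⟩⟩
  have hex : ∀ h : genericPoint X ∈ iSup U, ∃ i, genericPoint X ∈ U i := fun h ↦
    Opens.mem_iSup.mp h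
  refine ⟨⟨fun h ↦ (sf (hex h.down).choose).1 ⟨(hex h.down).choose_spec⟩, fun h ↦ ?_⟩, ?_, ?_⟩
  · refine E.locality _ _ _ fun x hx ↦ ?_
    obtain ⟨i, hi⟩ := Opens.mem_iSup.mp hx
    refine ⟨U i, genericPoint_mem_of_mem hi, hi, le_iSup U i, ?_⟩
    exact Eq.subst (motive := fun v ↦ v ∈ E.sections (U i) (genericPoint_mem_of_mem hi))
      (key i _ (genericPoint_mem_of_mem hi) _) ((sf i).2 ⟨genericPoint_mem_of_mem hi⟩)
  · intro i
    refine Subtype.ext (funext fun h ↦ ?_)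
    exact key _ i _ h.down
  · intro t ht
    refine Subtype.ext (funext fun h ↦ ?_)
    exact congrFun (congrArg Subtype.val (ht (hex h.down).choose)) ⟨(hex h.down).choose_spec⟩

/-- The sheaf of `𝒪_X`-modules given by a subsheaf of a constant sheaf. -/
def toModules : X.Modules where
  val := E.toPresheafOfModules
  isSheaf := E.isSheaf_toAb

variable {E E'}

/-- A `K(X)`-linear map `V → V'` which maps sections of `E` to sections of `E'` induces a morphism
of sheaves of modules. -/
def mapModules (μ : V →ₗ[X.functionField] V')
    (h : ∀ U hU, ∀ v ∈ E.sections U hU, μ v ∈ E'.sections U hU) :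
    E.toModules ⟶ E'.toModules :=
  SheafOfModules.Hom.mk <| PresheafOfModules.homMk
    { app := fun U ↦ AddCommGrpCat.ofHom (AddMonoidHom.mk'
        (fun s : E.gamma U.unop ↦ (⟨fun hU ↦ μ (s.1 hU), fun hU ↦ h _ _ _ (s.2 hU)⟩ :
          E'.gamma U.unop))
        fun _ _ ↦ Subtype.ext (funext fun _ ↦ map_add μ _ _))
      naturality := fun _ _ _ ↦ rfl }
    fun _ _ _ ↦ Subtype.ext (funext fun _ ↦ map_smul μ _ _)

end ConstSubsheaf

end Subsheaf

/-! ### Coherent and reflexive sheaves, generic stalks -/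

section Reflexive

variable {X : Scheme.{u}}

/-- Coherent sheaves on a locally Noetherian scheme: quasi-coherent sheaves whose sections over
every affine open set form a finitely generated module. -/
def IsCoherent (E : X.Modules) : Prop :=
  E.IsQuasicoherent ∧ ∀ U : X.affineOpens, Module.Finite Γ(X, U.1) Γ(E, U.1)

/-- A sheaf of modules is reflexive if it is coherent and the canonical map into its double dual
is an isomorphism. -/
def isReflexive (X : Scheme.{u}) : ObjectProperty X.Modules := fun E ↦
  IsCoherent E ∧ IsIso (DualModule.toBidual (R := X.presheaf) E.val)

/-- The category of reflexive sheaves on `X`, a full subcategory of the sheaves of modules. -/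
abbrev RefShe (X : Scheme.{u}) := (isReflexive X).FullSubcategory

variable [IsIntegral X]

/-- The module structure of a stalk over the stalk of the structure sheaf. -/
abbrev stalkModule {T : TopCat.{u}} {R : T.Presheaf CommRingCat.{u}}
    (M : PresheafOfModules.{u} (R ⋙ forget₂ CommRingCat RingCat)) (x : T) :
    Module (R.stalk x) ↑(TopCat.Presheaf.stalk M.presheaf x) := inferInstance

/-- The generic stalk `E_η`. -/
def GenericStalk (E : X.Modules) : Type u := E.presheaf.stalk (genericPoint X)

instance (E : X.Modules) : AddCommGroup (GenericStalk E) :=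
  inferInstanceAs (AddCommGroup (E.presheaf.stalk (genericPoint X)))

instance (E : X.Modules) : Module X.functionField (GenericStalk E) :=
  stalkModule (R := X.presheaf) E.val (genericPoint X)

/-- The map `E(U) → E_η`. -/
def genericGerm (E : X.Modules) (U : X.Opens) (hU : genericPoint X ∈ U) :
    Γ(E, U) →+ GenericStalk E :=
  (TopCat.Presheaf.germ E.presheaf U (genericPoint X) hU).hom

lemma genericGerm_smul (E : X.Modules) (U : X.Opens) (hU : genericPoint X ∈ U) (f : Γ(X, U))
    (s : Γ(E, U)) :
    genericGerm E U hU (f • s) = X.presheaf.germ U _ hU f • genericGerm E U hU s :=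
  PresheafOfModules.germ_smul (R := X.presheaf) E.val (genericPoint X) U hU f s

/-- The image of `E(U)` in `E_η`. -/
def genericImage (E : X.Modules) (U : X.Opens) (hU : genericPoint X ∈ U) : Set (GenericStalk E) :=
  Set.range (genericGerm E U hU)

lemma exists_genericGerm_eq (E : X.Modules) (f : X.functionField) (e : GenericStalk E) :
    ∃ (U : X.Opens) (hU : genericPoint X ∈ U) (f' : Γ(X, U)) (s : Γ(E, U)),
      X.presheaf.germ U _ hU f' = f ∧ genericGerm E U hU s = e := by
  obtain ⟨U, hU, f', rfl⟩ := X.presheaf.exists_germ_eq f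
  obtain ⟨U', hU', s, rfl⟩ := TopCat.Presheaf.exists_germ_eq E.presheaf e
  exact ⟨U ⊓ U', ⟨hU, hU'⟩, X.presheaf.map (homOfLE inf_le_left).op f',
    E.presheaf.map (homOfLE inf_le_right).op s, X.presheaf.germ_res_apply' _ _ _ _,
    TopCat.Presheaf.germ_res_apply' _ _ _ _ _⟩

/-- The additive map `E_η → E'_η` induced by a morphism of sheaves. -/
def genericStalkMapAdd {E E' : X.Modules} (φ : E ⟶ E') : GenericStalk E →+ GenericStalk E' :=
  ((TopCat.Presheaf.stalkFunctor Ab (genericPoint X)).map φ.mapPresheaf).hom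

lemma genericStalkMapAdd_germ {E E' : X.Modules} (φ : E ⟶ E') (U : X.Opens)
    (hU : genericPoint X ∈ U) (s : Γ(E, U)) :
    genericStalkMapAdd φ (genericGerm E U hU s) = genericGerm E' U hU (φ.app U s) :=
  TopCat.Presheaf.stalkFunctor_map_germ_apply U (genericPoint X) hU φ.mapPresheaf s

/-- The `K(X)`-linear map `φ_η : E_η → E'_η` induced by a morphism of sheaves. -/
def genericStalkMap {E E' : X.Modules} (φ : E ⟶ E') :
    GenericStalk E →ₗ[X.functionField] GenericStalk E' where
  __ := genericStalkMapAdd φ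
  map_smul' f e := by
    obtain ⟨U, hU, f', s, rfl, rfl⟩ := exists_genericGerm_eq E f e
    change genericStalkMapAdd φ _ = _ • genericStalkMapAdd φ _
    rw [← genericGerm_smul, genericStalkMapAdd_germ, genericStalkMapAdd_germ, RingHom.id_apply,
      ← genericGerm_smul, Scheme.Modules.Hom.app_smul]

lemma genericStalkMap_germ {E E' : X.Modules} (φ : E ⟶ E') (U : X.Opens)
    (hU : genericPoint X ∈ U) (s : Γ(E, U)) :
    genericStalkMap φ (genericGerm E U hU s) = genericGerm E' U hU (φ.app U s) :=
  genericStalkMapAdd_germ φ U hU s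

lemma genericStalkMap_id (E : X.Modules) : genericStalkMap (𝟙 E) = LinearMap.id := by
  ext e
  obtain ⟨U, hU, -, s, -, rfl⟩ := exists_genericGerm_eq E 0 e
  rw [genericStalkMap_germ]
  rfl

lemma genericStalkMap_comp {E E' E'' : X.Modules} (φ : E ⟶ E') (ψ : E' ⟶ E'') :
    genericStalkMap (φ ≫ ψ) = genericStalkMap ψ ∘ₗ genericStalkMap φ := by
  ext e
  obtain ⟨U, hU, -, s, -, rfl⟩ := exists_genericGerm_eq E 0 e
  rw [LinearMap.comp_apply, genericStalkMap_germ, genericStalkMap_germ, genericStalkMap_germ]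
  rfl

end Reflexive

/-! ### Weil decorations -/

section Decorations

variable {X : Scheme.{u}} [IsIntegral X] [IsNoetherian X]
  {V : Type u} [AddCommGroup V] [Module X.functionField V]

/-- Pre-Weil decorations on a vector space `V` over the function field. -/
structure IsPreWeilDecoration (W : V → WithTop (WeilDivisor X)) : Prop where
  eq_top_iff (v : V) : W v = ⊤ ↔ v = 0
  smul (f : X.functionField) (v : V) : W (f • v) = div f + W v
  add (v v' : V) : W v ⊓ W v' ≤ W (v + v')

lemma IsPreWeilDecoration.effectiveOn_smul {W : V → WithTop (WeilDivisor X)} (h : IsPreWeilDecoration W)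
    (U : X.Opens) (hU : genericPoint X ∈ U) (f : Γ(X, U)) (v : V) (hv : EffectiveOn (W v) U) :
    EffectiveOn (W (X.presheaf.germ U _ hU f • v)) U := by
  rw [h.smul]
  exact (effectiveOn_div_germ U hU f).add hv

/-- The sheaf `𝒪_X(W)` of a pre-Weil decoration `W` on `V`, as a subsheaf of the constant sheaf
`V`: its sections over a nonempty open set `U` are the `v ∈ V` with `W(v)|_U ≥ 0`. -/
def IsPreWeilDecoration.sheaf {W : V → WithTop (WeilDivisor X)} (h : IsPreWeilDecoration W) :
    ConstSubsheaf X V where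
  sections U hU :=
    { carrier := {v | EffectiveOn (W v) U}
      zero_mem' := by
        intro P hP
        rw [(h.eq_top_iff 0).mpr rfl]
        exact le_top
      add_mem' := fun ha hb ↦ EffectiveOn.of_inf_le ha hb (h.add _ _)
      neg_mem' := fun {v} hv ↦ by
        have := h.effectiveOn_smul U hU (-1) v hv
        rwa [map_neg, map_one, neg_one_smul] at this }
  smul_mem := h.effectiveOn_smul
  mono U U' _ _ hle v hv := fun P hP ↦ hv P (hle hP)
  locality U hU v H := fun P hP ↦ by
    obtain ⟨U', _, hP', _, hv⟩ := H P.1 hP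
    exact hv P hP'

/-- Weil decorations are the pre-Weil decorations with coherent associated sheaf. -/
structure IsWeilDecoration (W : V → WithTop (WeilDivisor X)) : Prop extends IsPreWeilDecoration W where
  isCoherent : IsCoherent toIsPreWeilDecoration.sheaf.toModules

/-- Let `S(U) ⊆ V` be the sections of a subsheaf of the constant sheaf `V`, and `e ∈ V`. The divisor
`D` satisfies `𝒪_X(D) ⬝ e = (K ⬝ e) ∩ S`: for all nonempty open sets `U`, the rational functions
`f` with `f ⬝ e ∈ S(U)` are exactly those with `(div(f) + D)|_U ≥ 0`. -/
def IsDivisorOf (S : ∀ U : X.Opens, genericPoint X ∈ U → Set V) (e : V) (D : WeilDivisor X) : Prop :=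
  ∀ (U : X.Opens) (hU : genericPoint X ∈ U) (f : X.functionField),
    EffectiveOn (div f + (D : WithTop (WeilDivisor X))) U ↔ f • e ∈ S U hU

open Classical in
/-- The map `W_S : V → Div(X) ∪ {∞}` which sends `0` to `∞` and `e ≠ 0` to the divisor `D` with
`𝒪_X(D) ⬝ e = (K ⬝ e) ∩ S` (and to `0` should there be no such divisor). -/
def decorationOf (S : ∀ U : X.Opens, genericPoint X ∈ U → Set V) (e : V) : WithTop (WeilDivisor X) :=
  if e = 0 then ⊤
  else if h : ∃ D : WeilDivisor X, IsDivisorOf S e D then (h.choose : WithTop (WeilDivisor X)) else 0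

/-- The map `W_E : E_η → Div(X) ∪ {∞}` of a sheaf of modules `E`. -/
def decorationOfSheaf (E : X.Modules) : GenericStalk E → WithTop (WeilDivisor X) :=
  decorationOf (genericImage E)

variable (X V)

/-- The Weil decorations on a fixed vector space. -/
abbrev WeilDecorationOn := {W : V → WithTop (WeilDivisor X) // IsWeilDecoration W}

/-- The reflexive sheaves with generic stalk `V`: the reflexive subsheaves of the constant sheaf
`V` with generic stalk all of `V`. -/
abbrev ReflexiveSheafOn := {E : ConstSubsheaf X V //
  isReflexive X E.toModules ∧ ∀ v : V, ∃ U hU, v ∈ E.sections U hU}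

/-- Weil decorations on `X`, on arbitrary finite-dimensional vector spaces over the function
field. -/
structure WeilDeco where
  space : Type u
  [addCommGroup : AddCommGroup space]
  [module : Module X.functionField space]
  [finite : Module.Finite X.functionField space]
  deco : space → WithTop (WeilDivisor X)
  isWeilDecoration : IsWeilDecoration deco

attribute [instance] WeilDeco.addCommGroup WeilDeco.module WeilDeco.finite

variable {X V}

/-- Morphisms of Weil decorations: the `K(X)`-linear maps `μ` with `W(v) ≤ W'(μ(v))`. -/
@[ext]
structure WeilDeco.Hom (W W' : WeilDeco X) where
  linearMap : W.space →ₗ[X.functionField] W'.space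
  le : ∀ v, W.deco v ≤ W'.deco (linearMap v)

instance : Category (WeilDeco X) where
  Hom := WeilDeco.Hom
  id W := ⟨LinearMap.id, fun _ ↦ le_rfl⟩
  comp μ ν := ⟨ν.linearMap ∘ₗ μ.linearMap, fun v ↦ (μ.le v).trans (ν.le _)⟩

/-- The sheaf `𝒪_X(W)` of a Weil decoration. -/
def WeilDeco.sheaf (W : WeilDeco X) : X.Modules :=
  W.isWeilDecoration.toIsPreWeilDecoration.sheaf.toModules

/-- The morphism `𝒪_X(W) → 𝒪_X(W')` induced by a morphism of Weil decorations. -/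
def WeilDeco.sheafMap {W W' : WeilDeco X} (μ : W ⟶ W') : W.sheaf ⟶ W'.sheaf :=
  ConstSubsheaf.mapModules (WeilDeco.Hom.linearMap μ) fun _ _ v hv ↦
    EffectiveOn.of_inf_le hv hv (by rw [inf_idem]; exact WeilDeco.Hom.le μ v)

/-- The functor `W ↦ 𝒪_X(W)` from Weil decorations to reflexive sheaves. It is defined as soon as
the sheaves `𝒪_X(W)` are known to be reflexive. -/
def sheafFunctor (hF : ∀ W : WeilDeco X, isReflexive X W.sheaf) : WeilDeco X ⥤ RefShe X :=
  (isReflexive X).lift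
    { obj := WeilDeco.sheaf
      map := WeilDeco.sheafMap
      map_id := fun _ ↦ rfl
      map_comp := fun _ _ ↦ rfl } hF

/-- The functor `E ↦ W_E`, `φ ↦ φ_η` from reflexive sheaves to Weil decorations. It is defined as
soon as the maps `W_E` are known to be Weil decorations, and the maps `φ_η` to be morphisms. -/
def decorationFunctor
    (hfin : ∀ E : RefShe X, Module.Finite X.functionField (GenericStalk E.obj))
    (hG : ∀ E : RefShe X, IsWeilDecoration (decorationOfSheaf E.obj))
    (hmap : ∀ (E E' : RefShe X) (φ : E ⟶ E') (e : GenericStalk E.obj),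
      decorationOfSheaf E.obj e ≤ decorationOfSheaf E'.obj (genericStalkMap φ.hom e)) :
    RefShe X ⥤ WeilDeco X where
  obj E :=
    { space := GenericStalk E.obj
      finite := hfin E
      deco := decorationOfSheaf E.obj
      isWeilDecoration := hG E }
  map {E E'} φ := ⟨genericStalkMap φ.hom, hmap E E' φ⟩
  map_id E := WeilDeco.Hom.ext (genericStalkMap_id E.obj)
  map_comp φ ψ := WeilDeco.Hom.ext (genericStalkMap_comp φ.hom ψ.hom)

end Decorations

end WeilDecorations
end

open WeilDecorations

/-! Both kinds of object are the same kind of lattice: a coherent subsheaf `E` of the constant sheaf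
`V` with generic stalk `V` (`IsFull`) whose sections are detected at the prime divisors
(`IsSaturated`).

Decorations. `𝒪_X(W)` is saturated because effectivity is tested one prime divisor at a time.
Conversely, let `E` be saturated, full and locally generated by finitely many sections, and let `e ≠
0`. The local ring at a prime divisor `P` is a discrete valuation ring, and the nonzero `f` with `f
• e ∈ E_P` are those with `ord_P f ≥ -m` for a unique integer `m` (`exists_multiplicity`). Almost
all of these integers vanish (`exists_hasMultiplicities`), so they form a divisor, and by saturation
the divisors of all vectors determine the sections of `E`. Hence decoration and lattice recover each
other (`IsPreWeilDecoration.deco_sheaf`, `IsSaturated.sheaf_deco`).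

Reflexivity. For coherent full lattices, reflexive means saturated (`Realization.isReflexive_iff`).
The dual lattice consists of the functionals `l` with `l(E_x) ⊆ 𝒪_x`, so reflexivity says that a
vector whose evaluation lies in the double dual already lies in `E`. This implies saturation by the
algebraic Hartogs lemma: on a normal scheme, a function regular in codimension one is regular
(`mem_regularOn_iff_primeDivisor`). Conversely, lattices over discrete valuation rings are free,
hence cut out by functionals (`exists_dual_separating`); so a vector in the double dual lies in all
stalks at prime divisors.

Abstract sheaves. A reflexive sheaf embeds into its generic stalk, because evaluation at a section
with zero generic germ vanishes (`genericGerm_injective`). A `Realization` records such an embedding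
and carries duals along, so that the canonical map to the bidual becomes `V → V**`. Linear maps
preserving sections do not lower decorations (`deco_le`), which gives functoriality. -/

namespace WeilDecorations

/-! ### Commutative algebra: denominators, discrete valuation rings, lattices -/

section Algebra

/-- A fraction `f ∉ A` has a multiple whose ideal of denominators is a nonzero prime ideal. -/
lemma exists_prime_denominators {A K : Type*} [CommRing A] [IsDomain A] [IsNoetherianRing A]
    [Field K] [Algebra A K] [IsFractionRing A K] (f : K) (hf : f ∉ (algebraMap A K).range) :
    ∃ (p : Ideal A) (c : A), p.IsPrime ∧ p ≠ ⊥ ∧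
      ∀ r : A, r ∈ p ↔ r • c • f ∈ (algebraMap A K).range := by
  -- An associated prime of the nonzero cyclic module generated by the class of `f` in `K / A` is
  -- the annihilator of some class `c • f`, that is, the ideal of denominators of `c • f`.
  let N : Submodule A K := LinearMap.range (Algebra.linearMap A K)
  have hN : ∀ z, z ∈ N ↔ z ∈ (algebraMap A K).range := fun z ↦ Iff.rfl
  let x : Submodule.span A {N.mkQ f} := ⟨N.mkQ f, Submodule.mem_span_singleton_self _⟩
  have hx : x ≠ 0 := fun h ↦ hf (by simpa [x, hN] using congrArg Subtype.val h)
  obtain ⟨p, hp, -⟩ := exists_le_isAssociatedPrime_of_isNoetherianRing A x hx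
  rw [isAssociatedPrime_iff] at hp
  obtain ⟨hp, ⟨y, hy⟩, hpy⟩ := hp
  obtain ⟨c, rfl⟩ := Submodule.mem_span_singleton.mp hy
  have key : ∀ r : A, r ∈ p ↔ r • c • f ∈ (algebraMap A K).range := by
    intro r
    rw [hpy, Submodule.mem_colon_singleton, Submodule.mem_bot, ← hN, ← Submodule.Quotient.mk_eq_zero,
      ← Submodule.mkQ_apply, map_smul, map_smul, Subtype.ext_iff]
    rfl
  refine ⟨p, c, hp, ?_, key⟩
  obtain ⟨a, b, hb, rfl⟩ := IsFractionRing.div_surjective (A := A) f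
  intro h0
  have hb0 : algebraMap A K b ≠ 0 := by simpa using nonZeroDivisors.ne_zero hb
  -- A denominator of `f` is also one of `c • f`, so `p` is nonzero.
  have : b ∈ p := (key b).mpr ⟨c * a, by
    rw [Algebra.smul_def, Algebra.smul_def, map_mul]; field_simp⟩
  rw [h0, Submodule.mem_bot] at this
  exact nonZeroDivisors.ne_zero hb this

/-- A normal Noetherian local domain of depth one is a discrete valuation ring. -/
lemma isDiscreteValuationRing_of_maximalIdeal_smul {R K : Type*} [CommRing R] [IsDomain R]
    [IsNoetherianRing R] [IsLocalRing R] [IsIntegrallyClosed R] [Field K] [Algebra R K]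
    [IsFractionRing R K] (g : K) (hg : g ∉ (algebraMap R K).range)
    (hm : ∀ r ∈ IsLocalRing.maximalIdeal R, r • g ∈ (algebraMap R K).range)
    (h0 : IsLocalRing.maximalIdeal R ≠ ⊥) : IsDiscreteValuationRing R := by
  have hinj := IsFractionRing.injective R K
  have hfield : ¬ IsField R := fun h ↦ h0 (IsLocalRing.isField_iff_maximalIdeal_eq.mp h)
  suffices h : (IsLocalRing.maximalIdeal R).IsPrincipal from
    ((IsDiscreteValuationRing.TFAE R hfield).out 0 4).mpr h
  -- Either `𝔪 g ⊆ 𝔪`, and `g` is integral by the determinant trick, or `t g` is a unit `w` for some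
  -- `t ∈ 𝔪`, and then `t` generates `𝔪`.
  by_cases H : ∀ r ∈ IsLocalRing.maximalIdeal R,
      ∃ s ∈ IsLocalRing.maximalIdeal R, algebraMap R K s = r • g
  · exfalso
    let N : Submodule R K := Submodule.map (Algebra.linearMap R K) (IsLocalRing.maximalIdeal R)
    have hint : IsIntegral R g := by
      refine isIntegral_of_smul_mem_submodule N ?_ ?_ g ?_
      · obtain ⟨r, hr, hr0⟩ := Submodule.exists_mem_ne_zero_of_ne_bot h0
        intro h
        have : algebraMap R K r ∈ N := ⟨r, hr, rfl⟩
        rw [h, Submodule.mem_bot] at this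
        exact hr0 (hinj (by rw [this, map_zero]))
      · exact (IsNoetherian.noetherian (IsLocalRing.maximalIdeal R)).map _
      · rintro _ ⟨r, hr, rfl⟩
        obtain ⟨s, hs, hs'⟩ := H r hr
        refine ⟨s, hs, ?_⟩
        change algebraMap R K s = g • algebraMap R K r
        rw [hs', Algebra.smul_def, smul_eq_mul, mul_comm]
    exact hg (IsIntegrallyClosed.isIntegral_iff.mp hint)
  · push Not at H
    obtain ⟨t, ht, ht'⟩ := H
    obtain ⟨w, hw⟩ := hm t ht
    have hwu : IsUnit w := by
      by_contra hwn
      exact ht' w ((IsLocalRing.mem_maximalIdeal w).mpr hwn) hw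
    have hg0 : g ≠ 0 := by rintro rfl; exact hg (zero_mem _)
    refine ⟨⟨t, le_antisymm (fun r hr ↦ ?_) (by simpa using ht)⟩⟩
    obtain ⟨s, hs⟩ := hm r hr
    obtain ⟨w', hw'⟩ := hwu.exists_right_inv
    -- With `s = r g` and `g = w / t`, one gets `r = w⁻¹ s t`.
    refine Ideal.mem_span_singleton.mpr ⟨w' * s, hinj ?_⟩
    rw [Algebra.smul_def] at hw hs
    have h1 : algebraMap R K w * algebraMap R K w' = 1 := by rw [← map_mul, hw', map_one]
    rw [map_mul, map_mul]
    apply mul_right_cancel₀ hg0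
    rw [← hs]
    linear_combination (algebraMap R K w' * algebraMap R K s) * hw - algebraMap R K s * h1

/-- A lattice in a vector space over the fraction field of a principal ideal domain is cut out by
linear functionals. -/
lemma exists_dual_separating {R K V : Type*} [CommRing R] [IsDomain R] [IsPrincipalIdealRing R]
    [Field K] [Algebra R K] [IsFractionRing R K] [AddCommGroup V] [Module K V] [Module R V]
    [IsScalarTower R K V] (N : Submodule R V) (hN : N.FG) (hspan : Submodule.span K (N : Set V) = ⊤)
    (v : V) (hv : v ∉ N) :
    ∃ l : V →ₗ[K] K, (∀ n ∈ N, l n ∈ (algebraMap R K).range) ∧ l v ∉ (algebraMap R K).range := by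
  have : Submodule.IsLattice K N := ⟨hN, hspan⟩
  have : Module.IsTorsionFree R K := inferInstance
  let b := Module.Free.chooseBasis R N
  let b' := b.extendOfIsLattice K
  have hb' : ∀ i, b' i = b i := fun i ↦ Module.Basis.extendOfIsLattice_apply K b i
  -- The separating functional is a coordinate: a basis of the free module `N` extends to one of
  -- `V`, and `v` would lie in `N` if all its coordinates were in `R`.
  by_contra! H
  have : ∀ i, ∃ r : R, algebraMap R K r = b'.coord i v := fun i ↦ H (b'.coord i) fun n hn ↦ by
    refine ⟨b.repr ⟨n, hn⟩ i, ?_⟩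
    have h1 : n = ∑ j, algebraMap R K (b.repr ⟨n, hn⟩ j) • b' j := by
      have := congrArg Subtype.val (b.sum_repr ⟨n, hn⟩)
      simp only [AddSubmonoidClass.coe_finsetSum, Submodule.coe_smul] at this
      refine this.symm.trans (Finset.sum_congr rfl fun j _ ↦ ?_)
      rw [hb', algebraMap_smul]
    conv_rhs => rw [h1]
    rw [map_sum]
    simp [Finsupp.single_apply, Algebra.smul_def]
  choose r hr using this
  apply hv
  rw [← b'.sum_repr v]
  refine sum_mem fun i _ ↦ ?_
  rw [← b'.coord_apply, ← hr, hb', algebraMap_smul]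
  exact N.smul_mem _ (b i).2

end Algebra

/-! ### Regular functions inside the function field -/

section Gluing

/-- If all germs at `x₀` are injective, then a germ at `x₀` extends to an open set as soon as it
does so locally. -/
lemma exists_germ_eq_of_locally {C : Type*} [Category.{u} C] {FC : C → C → Type*} {CC : C → Type u}
    [∀ A B, FunLike (FC A B) (CC A) (CC B)] [ConcreteCategory C FC] [Limits.HasColimits C]
    [Limits.HasLimits C] [(forget C).ReflectsIsomorphisms] [Limits.PreservesLimits (forget C)]
    [Limits.PreservesFilteredColimits (forget C)]
    {T : TopCat.{u}} (F : TopCat.Presheaf C T) (hF : F.IsSheaf) (x₀ : T)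
    (hinj : ∀ (U : Opens T) (hU : x₀ ∈ U), Function.Injective (F.germ U x₀ hU))
    (U : Opens T) (hU : x₀ ∈ U) (f : ToType (F.stalk x₀))
    (h : ∀ x ∈ U, ∃ (U' : Opens T) (hU' : x₀ ∈ U'), x ∈ U' ∧ U' ≤ U ∧
      ∃ s : ToType (F.obj (op U')), F.germ U' x₀ hU' s = f) :
    ∃ s : ToType (F.obj (op U)), F.germ U x₀ hU s = f := by
  choose U' hU' hx hle s hs using fun x : U ↦ h x.1 x.2
  -- Every `U' x` contains `x₀`, so the local sections agree on overlaps because their germs at `x₀`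
  -- do.
  obtain ⟨t, ht, -⟩ := TopCat.Sheaf.existsUnique_gluing' ⟨F, hF⟩ U' U (fun i ↦ homOfLE (hle i))
    (fun x hxU ↦ Opens.mem_iSup.mpr ⟨⟨x, hxU⟩, hx _⟩) s (fun i j ↦ by
      apply hinj (U' i ⊓ U' j) ⟨hU' i, hU' j⟩
      exact (TopCat.Presheaf.germ_res_apply F _ _ _ _).trans
        ((hs i).trans ((hs j).symm.trans (TopCat.Presheaf.germ_res_apply F _ _ _ _).symm)))
  refine ⟨t, ?_⟩
  rw [← hs ⟨x₀, hU⟩, ← ht ⟨x₀, hU⟩]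
  exact (TopCat.Presheaf.germ_res_apply F _ _ _ _).symm

end Gluing

section RegularFunctions

variable {X : Scheme.{u}} [IsIntegral X]

/-- The rational functions which are regular on a nonempty open set. -/
noncomputable def regularOn (U : X.Opens) (hU : genericPoint X ∈ U) : Subring X.functionField :=
  (X.presheaf.germ U (genericPoint X) hU).hom.range

/-- The rational functions which are regular at a point. -/
noncomputable def regularAt (x : X) : Subring X.functionField :=
  (algebraMap (X.presheaf.stalk x) X.functionField).range

lemma germ_mem_regularOn (U : X.Opens) (hU : genericPoint X ∈ U) (f : Γ(X, U)) :
    X.presheaf.germ U _ hU f ∈ regularOn U hU := ⟨f, rfl⟩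

lemma algebraMap_germ {U : X.Opens} {x : X} (hx : x ∈ U) (f : Γ(X, U)) :
    algebraMap (X.presheaf.stalk x) X.functionField (X.presheaf.germ U x hx f) =
      X.presheaf.germ U _ (genericPoint_mem_of_mem hx) f := by
  have : Nonempty U := ⟨⟨x, hx⟩⟩
  exact X.algebraMap_germ_eq_germToFunctionField hx f

lemma mem_regularAt_of_mem_regularOn {U : X.Opens} {hU : genericPoint X ∈ U} {x : X} (hx : x ∈ U)
    {f : X.functionField} (hf : f ∈ regularOn U hU) : f ∈ regularAt x := by
  obtain ⟨g, rfl⟩ := hf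
  exact ⟨X.presheaf.germ U x hx g, algebraMap_germ hx g⟩

lemma exists_mem_regularOn {x : X} {f : X.functionField} (hf : f ∈ regularAt x) :
    ∃ (U : X.Opens) (hU : genericPoint X ∈ U), x ∈ U ∧ f ∈ regularOn U hU := by
  obtain ⟨g, rfl⟩ := hf
  obtain ⟨U, hx, s, rfl⟩ := X.presheaf.exists_germ_eq g
  exact ⟨U, genericPoint_mem_of_mem hx, hx, s, (algebraMap_germ hx s).symm⟩

lemma regularOn_mono {U U' : X.Opens} {hU : genericPoint X ∈ U} (hU' : genericPoint X ∈ U')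
    (h : U' ≤ U) {f : X.functionField} (hf : f ∈ regularOn U hU) : f ∈ regularOn U' hU' := by
  obtain ⟨g, rfl⟩ := hf
  exact ⟨X.presheaf.map (homOfLE h).op g, X.presheaf.germ_res_apply (homOfLE h) _ hU' g⟩

/-- Regularity at a point spreads to a neighbourhood, and the local extensions glue since germs at
the generic point are injective. -/
lemma mem_regularOn_iff {U : X.Opens} {hU : genericPoint X ∈ U} {f : X.functionField} :
    f ∈ regularOn U hU ↔ ∀ x ∈ U, f ∈ regularAt x := by
  refine ⟨fun h x hx ↦ mem_regularAt_of_mem_regularOn hx h, fun h ↦ ?_⟩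
  refine exists_germ_eq_of_locally X.presheaf X.sheaf.property (genericPoint X)
    (fun U hU ↦ germ_injective_of_isIntegral X _ hU) U hU f fun x hx ↦ ?_
  obtain ⟨U', hU', hxU', hf⟩ := exists_mem_regularOn (h x hx)
  exact ⟨U ⊓ U', ⟨hU, hU'⟩, ⟨hx, hxU'⟩, inf_le_left, regularOn_mono _ inf_le_right hf⟩

lemma regularAt_genericPoint : regularAt (genericPoint X) = ⊤ := by
  refine eq_top_iff.mpr fun f _ ↦ ?_
  obtain ⟨U, hU, g, rfl⟩ := X.presheaf.exists_germ_eq f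
  exact mem_regularAt_of_mem_regularOn hU (germ_mem_regularOn U hU g)

/-- On `D(a)` the germ of `a` is a unit; this later undoes multiplication by powers of `a`. -/
lemma inv_germ_mem_regularAt {U : X.Opens} (hU : genericPoint X ∈ U) (a : Γ(X, U)) {x : X}
    (hx : x ∈ X.basicOpen a) :
    X.presheaf.germ U _ hU a ≠ 0 ∧ (X.presheaf.germ U _ hU a)⁻¹ ∈ regularAt x := by
  have hxU := X.basicOpen_le a hx
  obtain ⟨b, hb⟩ := ((X.mem_basicOpen a x hxU).mp hx).exists_right_inv
  have h := congrArg (algebraMap (X.presheaf.stalk x) X.functionField) hb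
  rw [map_mul, map_one, algebraMap_germ hxU] at h
  refine ⟨left_ne_zero_of_mul_eq_one h, b, ?_⟩
  exact eq_inv_of_mul_eq_one_right h

instance (x : X) : IsFractionRing (regularAt x) X.functionField := by
  refine IsFractionRing.of_field _ _ fun z ↦ ?_
  obtain ⟨a, b, -, rfl⟩ := IsFractionRing.div_surjective (A := X.presheaf.stalk x) z
  exact ⟨⟨_, a, rfl⟩, ⟨_, b, rfl⟩, rfl⟩

/-- Recognises as a prime divisor the point which the proof of the Hartogs lemma produces. -/
lemma coheight_eq_one_of_isDiscreteValuationRing (x : X)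
    [IsDiscreteValuationRing (X.presheaf.stalk x)] : Order.coheight x = 1 := by
  have h := ringKrullDim_stalk_eq_coheight x
  have h1 : ringKrullDim (X.presheaf.stalk x) = 1 :=
    IsPrincipalIdealRing.ringKrullDim_eq_one _ (IsDiscreteValuationRing.not_isField _)
  rw [h1] at h
  exact_mod_cast h.symm

variable [IsNoetherian X]

instance (x : X) : IsNoetherianRing (regularAt x) :=
  isNoetherianRing_of_surjective _ _ (algebraMap (X.presheaf.stalk x) X.functionField).rangeRestrict
    (RingHom.rangeRestrict_surjective _)

variable [∀ x : X, IsIntegrallyClosed (X.presheaf.stalk x)]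

/-- A normal Noetherian local domain of dimension one is a local Dedekind domain. -/
lemma isDiscreteValuationRing_stalk (P : PrimeDivisor X) :
    IsDiscreteValuationRing (X.presheaf.stalk P.1) := by
  have h := ringKrullDim_stalk_eq_coheight P.1
  rw [P.2] at h
  have hf : ¬ IsField (X.presheaf.stalk P.1) := fun hf ↦ by
    rw [ringKrullDim_eq_zero_of_isField hf] at h
    norm_num at h
  have : Ring.KrullDimLE 1 (X.presheaf.stalk P.1) := krullDimLE_of_coheight_le P.2.le
  have : Ring.DimensionLEOne (X.presheaf.stalk P.1) :=
    ⟨fun hp hp' ↦ Ring.krullDimLE_one_iff_of_noZeroDivisors.mp ‹_› _ hp hp'⟩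
  have : IsDedekindDomain (X.presheaf.stalk P.1) := {}
  exact ((IsDiscreteValuationRing.TFAE _ hf).out 0 2).mpr this

lemma isPrincipalIdealRing_regularAt (P : PrimeDivisor X) : IsPrincipalIdealRing (regularAt P.1) :=
  have := isDiscreteValuationRing_stalk P
  .of_surjective (algebraMap (X.presheaf.stalk P.1) X.functionField).rangeRestrict
    (RingHom.rangeRestrict_surjective _)

/-- In a valuation ring `f` or `f⁻¹` is integral. If `f⁻¹` is and `ord f ≥ 0`, then `f⁻¹` has order
zero and is a unit, so `f` is integral as well. -/
lemma mem_regularAt_primeDivisor_iff (P : PrimeDivisor X) {f : X.functionField} (hf : f ≠ 0) :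
    f ∈ regularAt P.1 ↔ 0 ≤ Scheme.ord f P.1 := by
  have := isDiscreteValuationRing_stalk P
  rw [Scheme.le_ord_iff P.2 hf]
  change _ ↔ 1 ≤ Ring.ordFrac (X.presheaf.stalk P.1) f
  constructor
  · rintro ⟨r, rfl⟩
    exact Ring.ordFrac_ge_one_of_ne_zero (by rintro rfl; simp at hf)
  · intro h
    rcases ValuationRing.isInteger_or_isInteger (X.presheaf.stalk P.1) f with h' | ⟨r, hr⟩
    · exact h'
    · have hr0 : r ≠ 0 := by rintro rfl; simp [eq_comm, hf] at hr
      have h1 := Ring.ordFrac_ge_one_of_ne_zero (K := X.functionField) hr0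
      have h2 : Ring.ordFrac (X.presheaf.stalk P.1) (algebraMap _ X.functionField r) = 1 := by
        refine le_antisymm ?_ h1
        rw [hr, map_inv₀]
        exact inv_le_one_of_one_le₀ h
      obtain ⟨s, hs⟩ := (Ring.isUnit_iff_ordFrac_one_of_isDiscreteValuationRing.mpr h2).exists_right_inv
      refine ⟨s, ?_⟩
      have h3 := congrArg (algebraMap (X.presheaf.stalk P.1) X.functionField) hs
      rw [map_mul, map_one, hr] at h3
      rw [← mul_one f, ← h3, mul_inv_cancel_left₀ hf]

/-- Powers of a uniformizer. Functions of prescribed order serve as probes whenever coefficients of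
divisors are compared. -/
lemma exists_ord_eq (P : PrimeDivisor X) (n : ℤ) :
    ∃ f : X.functionField, f ≠ 0 ∧ Scheme.ord f P.1 = n := by
  have := isDiscreteValuationRing_stalk P
  obtain ⟨w, hw⟩ := IsDiscreteValuationRing.exists_irreducible (X.presheaf.stalk P.1)
  have hw0 : algebraMap (X.presheaf.stalk P.1) X.functionField w ≠ 0 := by
    simpa using hw.ne_zero
  refine ⟨(algebraMap (X.presheaf.stalk P.1) X.functionField w) ^ n, zpow_ne_zero _ hw0, ?_⟩
  rw [Scheme.ord_eq_iff P.2 (zpow_ne_zero _ hw0), map_zpow₀]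
  have : Scheme.ordHom P.1 P.2 (algebraMap (X.presheaf.stalk P.1) X.functionField w) =
    WithZero.exp 1 := Ring.ordFrac_irreducible hw
  rw [this, ← WithZero.exp_zsmul]
  simp [WithZero.exp]

/-- On a normal scheme, a rational function which is regular in codimension one is regular. -/
lemma mem_regularOn_iff_primeDivisor {U : X.Opens} {hU : genericPoint X ∈ U}
    {f : X.functionField} :
    f ∈ regularOn U hU ↔ ∀ P : PrimeDivisor X, P.1 ∈ U → f ∈ regularAt P.1 := by
  refine ⟨fun h P hP ↦ mem_regularAt_of_mem_regularOn hP h, fun h ↦ mem_regularOn_iff.mpr ?_⟩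
  intro x hx
  obtain ⟨_, ⟨W, hW, rfl⟩, hxW, hWU⟩ := X.isBasis_affineOpens.exists_subset_of_mem_open hx U.isOpen
  replace hW : IsAffineOpen W := hW
  have hηW : genericPoint X ∈ W := genericPoint_mem_of_mem hxW
  refine mem_regularAt_of_mem_regularOn (hU := hηW) hxW ?_
  have : Nonempty W := ⟨⟨x, hxW⟩⟩
  have := functionField_isFractionRing_of_isAffineOpen X W hW
  have : IsNoetherianRing Γ(X, W) := IsLocallyNoetherian.component_noetherian ⟨W, hW⟩
  have hrange : ∀ g, g ∈ (algebraMap Γ(X, W) X.functionField).range ↔ g ∈ regularOn W hηW :=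
    fun g ↦ Iff.rfl
  by_contra hf
  -- If `f` is not regular on `W`, a multiple `g = c • f` has a nonzero prime `p` as its ideal of
  -- denominators. The aim is to show that the point `z` of `p` has codimension one.
  obtain ⟨p, c, hp, hp0, hpc⟩ := exists_prime_denominators (A := Γ(X, W)) f hf
  simp only [hrange] at hpc
  set g := c • f with hg
  let y : PrimeSpectrum Γ(X, W) := ⟨p, hp⟩
  have hyW : hW.fromSpec y ∈ W := by
    have : hW.fromSpec y ∈ hW.fromSpec.opensRange := ⟨y, rfl⟩
    rwa [hW.opensRange_fromSpec] at this
  set z := hW.fromSpec y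
  let := TopCat.Presheaf.algebra_section_stalk X.presheaf (⟨z, hyW⟩ : W)
  have hloc : IsLocalization.AtPrime (X.presheaf.stalk z) p := hW.isLocalization_stalk' y hyW
  have hsm : ∀ (r : Γ(X, W)) (k : X.functionField), r • k = X.presheaf.germ W _ hηW r * k :=
    fun r k ↦ rfl
  have hgerm : ∀ r : Γ(X, W), algebraMap (X.presheaf.stalk z) X.functionField
      (algebraMap Γ(X, W) (X.presheaf.stalk z) r) = X.presheaf.germ W _ hηW r := fun r ↦
    algebraMap_germ hyW r
  have hunit : ∀ s ∉ p, IsUnit (algebraMap Γ(X, W) (X.presheaf.stalk z) s) := fun s hs ↦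
    IsLocalization.map_units (M := p.primeCompl) _ ⟨s, hs⟩
  -- Regularity of `g` at `z` would produce a denominator of `g` outside `p`.
  have hgz : g ∉ regularAt z := by
    rintro ⟨w, hw⟩
    obtain ⟨⟨b, s⟩, hbs⟩ := IsLocalization.surj p.primeCompl w
    refine s.2 ((hpc s.1).mpr ⟨b, ?_⟩)
    have := congrArg (algebraMap (X.presheaf.stalk z) X.functionField) hbs
    rw [map_mul, hgerm, hgerm, hw] at this
    rw [hsm, mul_comm]
    exact this.symm
  have hmap : ∀ r ∈ p, algebraMap Γ(X, W) (X.presheaf.stalk z) r ∈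
      IsLocalRing.maximalIdeal (X.presheaf.stalk z) := fun r hr ↦ by
    rw [← IsLocalization.AtPrime.map_eq_maximalIdeal p]
    exact Ideal.mem_map_of_mem _ hr
  -- Up to units, elements of the maximal ideal at `z` come from `p`, so they multiply `g` into the
  -- local ring although `g` is not in it.
  have : IsDiscreteValuationRing (X.presheaf.stalk z) := by
    refine isDiscreteValuationRing_of_maximalIdeal_smul g hgz (fun r hr ↦ ?_) fun h0 ↦ ?_
    · obtain ⟨⟨b, s⟩, hbs⟩ := IsLocalization.surj p.primeCompl r
      have hb : b ∈ p := by
        by_contra hb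
        have := hunit b hb
        rw [← hbs] at this
        exact (IsLocalRing.mem_maximalIdeal r).mp hr (isUnit_of_mul_isUnit_left this)
      obtain ⟨w, hw⟩ := (hunit _ s.2).exists_right_inv
      have h1 : r = w * algebraMap Γ(X, W) (X.presheaf.stalk z) b := by
        rw [← hbs, mul_left_comm, mul_comm w, hw, mul_one]
      obtain ⟨v, hv⟩ := mem_regularAt_of_mem_regularOn hyW ((hpc b).mp hb)
      refine ⟨w * v, ?_⟩
      rw [h1, Algebra.smul_def, map_mul, map_mul, hgerm, hv, hsm, mul_assoc]
    · obtain ⟨r, hr, hr0⟩ := Submodule.exists_mem_ne_zero_of_ne_bot hp0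
      have h1 := hmap r hr
      rw [h0, Submodule.mem_bot] at h1
      have h2 := hgerm r
      rw [h1, map_zero] at h2
      exact hr0 (germ_injective_of_isIntegral X _ hηW (h2.symm.trans (map_zero _).symm))
  -- So `z` is a prime divisor in `U`; there `f`, and hence `g`, is regular, a contradiction.
  have hzf := h ⟨z, coheight_eq_one_of_isDiscreteValuationRing z⟩ (hWU hyW)
  refine hgz ?_
  rw [hg, hsm]
  exact mul_mem (mem_regularAt_of_mem_regularOn hyW (germ_mem_regularOn W hηW c)) hzf

end RegularFunctions

/-! ### Open sets which avoid prime divisors -/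

section Divisors

variable {X : Scheme.{u}}

lemma exists_open_forall_not_mem {F : Set (PrimeDivisor X)} (hF : F.Finite) (x : X)
    (hx : ∀ Q ∈ F, ¬ Q.1 ⤳ x) : ∃ U : X.Opens, x ∈ U ∧ ∀ Q ∈ F, Q.1 ∉ U := by
  refine ⟨⟨(⋃ Q ∈ F, closure {Q.1})ᶜ, (hF.isClosed_biUnion fun _ _ ↦ isClosed_closure).isOpen_compl⟩,
    ?_, ?_⟩
  · change x ∈ (_ : Set X)ᶜ
    simp only [Set.mem_compl_iff, Set.mem_iUnion, not_exists]
    exact fun Q hQ h ↦ hx Q hQ (specializes_iff_mem_closure.mpr h)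
  · intro Q hQ h
    exact h (Set.mem_biUnion hQ (subset_closure rfl))

/-- A proper specialization strictly increases the codimension. -/
lemma PrimeDivisor.eq_of_specializes {P Q : PrimeDivisor X} (h : Q.1 ⤳ P.1) : Q = P := by
  by_contra hne
  have h1 : P.1 < Q.1 := lt_of_le_not_ge h fun h' ↦ hne (Subtype.ext (Specializes.antisymm h h').eq)
  have e1 := Order.coheight_add_one_le h1
  rw [P.2, Q.2] at e1
  norm_num at e1

lemma PrimeDivisor.not_specializes_genericPoint [IsIntegral X] (Q : PrimeDivisor X) :
    ¬ Q.1 ⤳ genericPoint X := fun h ↦ by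
  have h1 : Q.1 = genericPoint X := (Specializes.antisymm h (genericPoint_specializes _)).eq
  have h2 : IsMax (genericPoint X) := fun y _ ↦ genericPoint_specializes y
  have h3 := Q.2
  rw [h1, Order.coheight_eq_zero.mpr h2] at h3
  norm_num at h3

/-- Only finitely many coefficients are negative, and none of the corresponding divisors contains
the generic point of `P`; remove them. -/
lemma exists_open_effectiveOn {D : WithTop (WeilDivisor X)} {P : PrimeDivisor X}
    (h : 0 ≤ coeffAt P D) : ∃ U : X.Opens, P.1 ∈ U ∧ EffectiveOn D U := by
  induction D with
  | top => exact ⟨⊤, trivial, fun _ _ ↦ le_top⟩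
  | coe D =>
    obtain ⟨U, hU, hU'⟩ := exists_open_forall_not_mem (F := {Q | D Q < 0})
      (D.support.finite_toSet.subset fun Q hQ ↦ by
        simpa using (show D Q < 0 from hQ).ne) P.1 fun Q hQ hs ↦ by
          obtain rfl := PrimeDivisor.eq_of_specializes hs
          exact absurd (WithTop.coe_le_coe.mp h) (not_le.mpr hQ)
    exact ⟨U, hU, fun Q hQ ↦ WithTop.coe_le_coe.mpr (not_lt.mp fun hlt ↦ hU' Q hlt hQ)⟩

lemma exists_open_genericPoint_effectiveOn [IsIntegral X] (D : WithTop (WeilDivisor X)) :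
    ∃ U : X.Opens, genericPoint X ∈ U ∧ EffectiveOn D U := by
  induction D with
  | top => exact ⟨⊤, trivial, fun _ _ ↦ le_top⟩
  | coe D =>
    obtain ⟨U, hU, hU'⟩ := exists_open_forall_not_mem (F := {Q | D Q < 0})
      (D.support.finite_toSet.subset fun Q hQ ↦ by
        simpa using (show D Q < 0 from hQ).ne) (genericPoint X) fun Q _ ↦
          Q.not_specializes_genericPoint
    exact ⟨U, hU, fun Q hQ ↦ WithTop.coe_le_coe.mpr (not_lt.mp fun hlt ↦ hU' Q hlt hQ)⟩

end Divisors

/-! ### Extending sections of quasi-coherent sheaves -/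

section Quasicoherent

variable {X : Scheme.{u}}

/-- Compares the two ways in which `Γ(X, U)` acts on sections over a smaller open set: through its
spectrum and by restriction in `X`. -/
lemma fromSpec_appIso_inv_apply {U : X.Opens} (hU : IsAffineOpen U)
    (D : (Spec Γ(X, U)).Opens) (hD : hU.fromSpec ''ᵁ D ≤ U) (a : Γ(X, U)) :
    (hU.fromSpec.appIso D).inv ((Spec Γ(X, U)).presheaf.map D.leTop.op
      ((Scheme.ΓSpecIso Γ(X, U)).inv a)) = X.presheaf.map (homOfLE hD).op a := by
  have h : (Scheme.ΓSpecIso Γ(X, U)).inv ≫ (Spec Γ(X, U)).presheaf.map D.leTop.op ≫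
      (hU.fromSpec.appIso D).inv = X.presheaf.map (homOfLE hD).op := by
    rw [← Category.assoc, Iso.comp_inv_eq, Scheme.Hom.appIso_hom', Scheme.Hom.map_appLE,
      Scheme.Hom.appLE, hU.fromSpec_app_self, Category.assoc, ← Functor.map_comp]
    rfl
  exact congr($h a)

/-- A section of a quasi-coherent sheaf over a principal open subset `D(a)` of an affine open set
extends after multiplication by a power of `a`. -/
lemma exists_extension_of_isQuasicoherent (E : X.Modules) [E.IsQuasicoherent] {U : X.Opens}
    (hU : IsAffineOpen U) (a : Γ(X, U)) (s : Γ(E, X.basicOpen a)) :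
    ∃ (n : ℕ) (t : Γ(E, U)), E.presheaf.map (homOfLE (X.basicOpen_le a)).op t =
      X.presheaf.map (homOfLE (X.basicOpen_le a)).op (a ^ n) • s := by
  -- On the spectrum a quasi-coherent sheaf comes from a module, so its sections over `D(a)` are the
  -- localization of the global ones at `a`; a numerator there is transported back to `X`.
  let M : (Spec Γ(X, U)).Modules := E.restrict hU.fromSpec
  have hM : IsIso M.fromTildeΓ := inferInstance
  have hloc := (isIso_fromTildeΓ_iff_isLocalizing M).mp hM a
  let D : (Spec Γ(X, U)).Opens := PrimeSpectrum.basicOpen a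
  have hD : hU.fromSpec ''ᵁ D = X.basicOpen a := hU.fromSpec_image_basicOpen a
  have hT : hU.fromSpec ''ᵁ ⊤ = U := by rw [hU.fromSpec.image_top_eq_opensRange, hU.opensRange_fromSpec]
  have hDU : hU.fromSpec ''ᵁ D ≤ U := hD.le.trans (X.basicOpen_le a)
  let s' : Γ(E, hU.fromSpec ''ᵁ D) := E.presheaf.map (homOfLE hD.le).op s
  obtain ⟨⟨y, ⟨_, n, rfl⟩⟩, hy⟩ := hloc.surj ((E.restrictAppIso hU.fromSpec D).inv s')
  refine ⟨n, E.presheaf.map (homOfLE hT.ge).op ((E.restrictAppIso hU.fromSpec ⊤).hom y), ?_⟩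
  have hy' : a ^ n • (E.restrictAppIso hU.fromSpec D).inv s' =
    M.presheaf.map D.leTop.op y := hy
  have h1 := congrArg (E.restrictAppIso hU.fromSpec D).hom hy'
  have h2 : (E.restrictAppIso hU.fromSpec D).hom (a ^ n • (E.restrictAppIso hU.fromSpec D).inv s') =
      X.presheaf.map (homOfLE hDU).op (a ^ n) • s' := by
    rw [Scheme.Modules.smul_Spec_def, ← fromSpec_appIso_inv_apply hU D hDU]
    rfl
  have h3 : (E.restrictAppIso hU.fromSpec D).hom (M.presheaf.map D.leTop.op y) =
    E.presheaf.map (homOfLE (hU.fromSpec.image_mono le_top)).op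
      ((E.restrictAppIso hU.fromSpec ⊤).hom y) := rfl
  rw [h2, h3] at h1
  -- The image of `D` and `X.basicOpen a` are equal, but not by definition; restriction along the
  -- equality returns to the original section.
  have h4 := congrArg (E.presheaf.map (homOfLE hD.ge).op) h1
  rw [Scheme.Modules.map_smul, ← ConcreteCategory.comp_apply, ← ConcreteCategory.comp_apply,
    ← ConcreteCategory.comp_apply, ← Functor.map_comp, ← Functor.map_comp, ← Functor.map_comp] at h4
  rw [← ConcreteCategory.comp_apply, ← Functor.map_comp]
  refine h4.symm.trans ?_
  congr 1
  exact congr($(E.presheaf.map_id _) s)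

end Quasicoherent

/-! ### Lattices in vector spaces over the function field -/

namespace ConstSubsheaf

section Stalks

variable {X : Scheme.{u}} [IsIntegral X] {V : Type u} [AddCommGroup V] [Module X.functionField V]
  (E : ConstSubsheaf X V)

lemma smul_mem_sections {U : X.Opens} {hU : genericPoint X ∈ U} {f : X.functionField}
    (hf : f ∈ regularOn U hU) {v : V} (hv : v ∈ E.sections U hU) : f • v ∈ E.sections U hU := by
  obtain ⟨f, rfl⟩ := hf
  exact E.smul_mem U hU f v hv

/-- The stalk of a subsheaf of a constant sheaf. -/
def stalkAt (x : X) : Submodule (regularAt x) V where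
  carrier := {v | ∃ (U : X.Opens) (hU : genericPoint X ∈ U), x ∈ U ∧ v ∈ E.sections U hU}
  zero_mem' := ⟨⊤, trivial, trivial, zero_mem _⟩
  add_mem' := by
    rintro a b ⟨U, hU, hx, ha⟩ ⟨U', hU', hx', hb⟩
    exact ⟨U ⊓ U', ⟨hU, hU'⟩, ⟨hx, hx'⟩, add_mem (E.mono U _ hU _ inf_le_left ha)
      (E.mono U' _ hU' _ inf_le_right hb)⟩
  smul_mem' := by
    rintro ⟨f, hf⟩ v ⟨U, hU, hx, hv⟩
    obtain ⟨U', hU', hx', hf'⟩ := exists_mem_regularOn hf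
    exact ⟨U ⊓ U', ⟨hU, hU'⟩, ⟨hx, hx'⟩, E.smul_mem_sections
      (regularOn_mono _ inf_le_right hf') (E.mono U _ hU _ inf_le_left hv)⟩

variable {E}

lemma mem_stalkAt_of_mem_sections {U : X.Opens} {hU : genericPoint X ∈ U} {v : V}
    (hv : v ∈ E.sections U hU) {x : X} (hx : x ∈ U) : v ∈ E.stalkAt x := ⟨U, hU, hx, hv⟩

lemma smul_mem_stalkAt {x : X} {f : X.functionField} (hf : f ∈ regularAt x) {v : V}
    (hv : v ∈ E.stalkAt x) : f • v ∈ E.stalkAt x := (E.stalkAt x).smul_mem ⟨f, hf⟩ hv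

variable (E)

/-- The generic stalk is the whole vector space. -/
def IsFull : Prop := ∀ v : V, ∃ U hU, v ∈ E.sections U hU

/-- Sections are determined in codimension one. -/
def IsSaturated : Prop := ∀ U hU (v : V),
  (∀ P : PrimeDivisor X, P.1 ∈ U → v ∈ E.stalkAt P.1) → v ∈ E.sections U hU

/-- Locally, the stalks are generated by finitely many sections. -/
def IsLocallyGenerated : Prop := ∀ x : X, ∃ U : X.Opens, x ∈ U ∧ ∃ s : Set V, s.Finite ∧
  ∀ y ∈ U, E.stalkAt y = Submodule.span (regularAt y) s

/-- The dual of a subsheaf of a constant sheaf, as a subsheaf of the dual constant sheaf. -/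
def dual : ConstSubsheaf X (Module.Dual X.functionField V) where
  sections U _ :=
    { carrier := {l | ∀ x ∈ U, ∀ v ∈ E.stalkAt x, l v ∈ regularAt x}
      zero_mem' := fun x _ v _ ↦ zero_mem _
      add_mem' := fun ha hb x hx v hv ↦ add_mem (ha x hx v hv) (hb x hx v hv)
      neg_mem' := fun ha x hx v hv ↦ neg_mem (ha x hx v hv) }
  smul_mem U hU f l hl x hx v hv :=
    mul_mem (mem_regularAt_of_mem_regularOn hx (germ_mem_regularOn U hU f)) (hl x hx v hv)
  mono U U' _ _ h l hl x hx := hl x (h hx)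
  locality U hU l H x hx := by
    obtain ⟨U', hU', hx', -, hl⟩ := H x hx
    exact hl x hx'

variable {E}

lemma IsFull.mem_stalkAt_genericPoint (h : E.IsFull) (v : V) : v ∈ E.stalkAt (genericPoint X) := by
  obtain ⟨U, hU, hv⟩ := h v
  exact ⟨U, hU, hU, hv⟩

lemma exists_regularOn_of_finite {x : X} {s : Set X.functionField} (hs : s.Finite)
    (h : ∀ f ∈ s, f ∈ regularAt x) :
    ∃ (U : X.Opens) (hU : genericPoint X ∈ U), x ∈ U ∧ ∀ f ∈ s, f ∈ regularOn U hU := by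
  induction s, hs using Set.Finite.induction_on with
  | empty => exact ⟨⊤, trivial, trivial, by simp⟩
  | @insert a s _ _ ih =>
    obtain ⟨U, hU, hx, H⟩ := ih fun f hf ↦ h f (Set.mem_insert_of_mem _ hf)
    obtain ⟨U', hU', hx', H'⟩ := exists_mem_regularOn (h a (Set.mem_insert _ _))
    refine ⟨U ⊓ U', ⟨hU, hU'⟩, ⟨hx, hx'⟩, fun f hf ↦ ?_⟩
    rcases hf with rfl | hf
    · exact regularOn_mono _ inf_le_right H'
    · exact regularOn_mono _ inf_le_left (H f hf)

/-- Integrality of `l` at `x` spreads to a neighbourhood, since only its values on finitely many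
local generators matter. -/
lemma IsLocallyGenerated.mem_stalkAt_dual (h : E.IsLocallyGenerated) {x : X}
    {l : Module.Dual X.functionField V} (hl : ∀ v ∈ E.stalkAt x, l v ∈ regularAt x) :
    l ∈ E.dual.stalkAt x := by
  obtain ⟨U, hx, s, hs, H⟩ := h x
  obtain ⟨U', hU', hx', H'⟩ := exists_regularOn_of_finite (x := x) (hs.image l) (by
    rintro _ ⟨v, hv, rfl⟩
    exact hl v (H x hx ▸ Submodule.subset_span hv))
  refine ⟨U ⊓ U', ⟨genericPoint_mem_of_mem hx, hU'⟩, ⟨hx, hx'⟩, fun y hy v hv ↦ ?_⟩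
  rw [H y hy.1] at hv
  induction hv using Submodule.span_induction with
  | mem v hv => exact mem_regularAt_of_mem_regularOn hy.2 (H' _ ⟨v, hv, rfl⟩)
  | zero => rw [map_zero]; exact zero_mem _
  | add a b _ _ ha hb => rw [map_add]; exact add_mem ha hb
  | smul r a _ ha =>
    rw [Subring.smul_def, map_smul, smul_eq_mul]
    exact mul_mem r.2 ha

lemma IsLocallyGenerated.dual_isFull (h : E.IsLocallyGenerated) : E.dual.IsFull := fun l ↦ by
  obtain ⟨U, hU, -, hl⟩ := h.mem_stalkAt_dual (x := genericPoint X) (l := l) fun v _ ↦ by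
    rw [regularAt_genericPoint]; trivial
  exact ⟨U, hU, hl⟩

/-- The local generators near `x` also generate the generic stalk, which is all of `V`. -/
lemma span_stalkAt_eq_top (h : E.IsLocallyGenerated) (hf : E.IsFull) (x : X) :
    Submodule.span X.functionField (E.stalkAt x : Set V) = ⊤ := by
  obtain ⟨U, hx, s, hs, H⟩ := h x
  refine eq_top_iff.mpr fun v _ ↦ ?_
  have hv := hf.mem_stalkAt_genericPoint v
  rw [H _ (genericPoint_mem_of_mem hx)] at hv
  rw [H x hx]
  exact Submodule.span_mono Submodule.subset_span (Submodule.span_subset_span _ X.functionField s hv)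

lemma finite_of_isLocallyGenerated (h : E.IsLocallyGenerated) (hf : E.IsFull) :
    Module.Finite X.functionField V := by
  obtain ⟨U, hx, s, hs, H⟩ := h (genericPoint X)
  refine ⟨⟨hs.toFinset, eq_top_iff.mpr fun v _ ↦ ?_⟩⟩
  have hv := hf.mem_stalkAt_genericPoint v
  rw [H _ hx] at hv
  rw [hs.coe_toFinset]
  exact Submodule.span_subset_span _ X.functionField s hv

lemma stalkAt_fg (h : E.IsLocallyGenerated) (x : X) : (E.stalkAt x).FG := by
  obtain ⟨U, hx, s, hs, H⟩ := h x
  exact ⟨hs.toFinset, by rw [hs.coe_toFinset, H x hx]⟩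

lemma exists_smul_mem_stalkAt (h : E.IsLocallyGenerated) (hf : E.IsFull) (x : X) (v : V) :
    ∃ c : X.functionField, c ≠ 0 ∧ c • v ∈ E.stalkAt x := by
  -- The multiplier is sought in the local ring, so that it preserves the stalk; the case of sums
  -- needs this.
  suffices ∃ c : regularAt x, c.1 ≠ 0 ∧ c.1 • v ∈ E.stalkAt x from
    let ⟨c, hc⟩ := this; ⟨c.1, hc⟩
  have hv : v ∈ Submodule.span X.functionField (E.stalkAt x : Set V) := by
    rw [span_stalkAt_eq_top h hf]; trivial
  induction hv using Submodule.span_induction with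
  | mem v hv => exact ⟨1, one_ne_zero, by simpa using hv⟩
  | zero => exact ⟨1, one_ne_zero, by simp⟩
  | add a b _ _ ha hb =>
    obtain ⟨c, hc, hca⟩ := ha
    obtain ⟨d, hd, hdb⟩ := hb
    refine ⟨c * d, mul_ne_zero hc hd, ?_⟩
    rw [smul_add]
    refine add_mem ?_ ?_
    · rw [Subring.coe_mul, mul_comm, mul_smul]
      exact smul_mem_stalkAt d.2 hca
    · rw [Subring.coe_mul, mul_smul]
      exact smul_mem_stalkAt c.2 hdb
  | smul r a _ ha =>
    obtain ⟨c, hc, hca⟩ := ha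
    obtain ⟨p, q, hq, rfl⟩ := IsFractionRing.div_surjective (A := regularAt x) r
    have hq0 : q.1 ≠ 0 := fun h0 ↦ nonZeroDivisors.ne_zero hq (Subtype.ext h0)
    refine ⟨c * q, mul_ne_zero hc hq0, ?_⟩
    have : (c * q).1 • (algebraMap (regularAt x) X.functionField p /
        algebraMap (regularAt x) X.functionField q) • a = p.1 • c.1 • a := by
      rw [smul_smul, smul_smul]
      congr 1
      change c.1 * q.1 * (p.1 / q.1) = p.1 * c.1
      field_simp
    rw [this]
    exact smul_mem_stalkAt p.2 hca

end Stalks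

/-! ### Saturated lattices and the double dual -/

section Reflexivity

variable {X : Scheme.{u}} [IsIntegral X] [IsNoetherian X]
  [∀ x : X, IsIntegrallyClosed (X.presheaf.stalk x)]
  {V : Type u} [AddCommGroup V] [Module X.functionField V] {E : ConstSubsheaf X V}

/-- Saturation reduces to a prime divisor, where the stalk is a lattice over a principal ideal
domain. A functional separating `v` from it belongs to the stalk of the dual, against the hypothesis
on `v`. -/
lemma IsSaturated.mem_of_eval_mem (hs : E.IsSaturated) (h : E.IsLocallyGenerated) (hf : E.IsFull)
    {U : X.Opens} {hU : genericPoint X ∈ U} {v : V}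
    (hv : Module.Dual.eval X.functionField V v ∈ E.dual.dual.sections U hU) :
    v ∈ E.sections U hU := by
  refine hs U hU v fun P hP ↦ ?_
  have := isPrincipalIdealRing_regularAt P
  by_contra hvP
  obtain ⟨l, hl, hlv⟩ := exists_dual_separating (K := X.functionField) (E.stalkAt P.1)
    (stalkAt_fg h P.1) (span_stalkAt_eq_top h hf P.1) v hvP
  have hr : ∀ f, f ∈ (algebraMap (regularAt P.1) X.functionField).range ↔ f ∈ regularAt P.1 :=
    fun f ↦ ⟨fun ⟨g, hg⟩ ↦ hg ▸ g.2, fun hf ↦ ⟨⟨f, hf⟩, rfl⟩⟩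
  simp only [hr] at hl hlv
  exact hlv (hv P.1 hP l (h.mem_stalkAt_dual hl))

/-- If `v` lies in the stalks at prime divisors and `l` in the dual near `x`, then `l v` is regular
in codimension one near `x`, hence at `x` by Hartogs. -/
lemma isSaturated_of_forall_eval_mem
    (h : ∀ U hU v, Module.Dual.eval X.functionField V v ∈ E.dual.dual.sections U hU →
      v ∈ E.sections U hU) : E.IsSaturated := fun U hU v hv ↦ by
  refine h U hU v fun x hx l hl ↦ ?_
  obtain ⟨U', hU', hx', hl⟩ := hl
  have : l v ∈ regularOn (U ⊓ U') ⟨hU, hU'⟩ :=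
    mem_regularOn_iff_primeDivisor.mpr fun P hP ↦ hl P.1 hP.2 v (hv P hP.1)
  exact mem_regularAt_of_mem_regularOn (U := U ⊓ U') ⟨hx, hx'⟩ this

end Reflexivity

end ConstSubsheaf

/-! ### The decoration of a lattice -/

section Coefficients

lemma exists_dual_apply_eq_one {K V : Type*} [Field K] [AddCommGroup V] [Module K V] {v : V}
    (hv : v ≠ 0) : ∃ l : Module.Dual K V, l v = 1 := by
  by_contra! H
  refine hv ((Module.forall_dual_apply_eq_zero_iff K v).mp fun l ↦ ?_)
  by_contra h
  exact H ((l v)⁻¹ • l) (by simp [h])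

variable {X : Scheme.{u}} [IsIntegral X] [IsNoetherian X]

lemma div_zero : div (0 : X.functionField) = ⊤ := if_pos rfl

lemma coeffAt_div_add_nonneg_iff {f : X.functionField} (hf : f ≠ 0) (D : WeilDivisor X)
    (P : PrimeDivisor X) :
    0 ≤ coeffAt P (div f + (D : WithTop (WeilDivisor X))) ↔ 0 ≤ Scheme.ord f P.1 + D P := by
  rw [div, if_neg hf]
  exact WithTop.coe_le_coe

lemma ord_inv_add {f : X.functionField} (hf : f ≠ 0) (x : X) :
    Scheme.ord f⁻¹ x = - Scheme.ord f x := by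
  have h := Scheme.ord_mul (x := x) hf (inv_ne_zero hf)
  have h1 := Scheme.ord_mul (x := x) (one_ne_zero (α := X.functionField)) one_ne_zero
  rw [one_mul] at h1
  rw [mul_inv_cancel₀ hf] at h
  omega

end Coefficients

namespace ConstSubsheaf

section Divisors

variable {X : Scheme.{u}} [IsIntegral X] [IsNoetherian X]
  {V : Type u} [AddCommGroup V] [Module X.functionField V] {E : ConstSubsheaf X V}

/-- Along each prime divisor, `D` is the multiplicity of `e` with respect to the lattice `E`. -/
def HasMultiplicities (E : ConstSubsheaf X V) (e : V) (D : WeilDivisor X) : Prop :=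
  ∀ (P : PrimeDivisor X) (f : X.functionField), f ≠ 0 →
    (f • e ∈ E.stalkAt P.1 ↔ 0 ≤ Scheme.ord f P.1 + D P)

lemma HasMultiplicities.mem_stalkAt_iff {e : V} {D : WeilDivisor X}
    (h : E.HasMultiplicities e D) (P : PrimeDivisor X) : e ∈ E.stalkAt P.1 ↔ 0 ≤ D P := by
  have h1 := h P 1 one_ne_zero
  have h2 := Scheme.ord_mul (x := P.1) (one_ne_zero (α := X.functionField)) one_ne_zero
  rw [one_mul] at h2
  rw [one_smul] at h1
  rw [h1]
  omega

/-- The decoration of a subsheaf of a constant sheaf. -/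
noncomputable abbrev deco (E : ConstSubsheaf X V) : V → WithTop (WeilDivisor X) :=
  decorationOf (fun U hU ↦ (E.sections U hU : Set V))

lemma deco_zero : E.deco 0 = ⊤ := if_pos rfl

/-- Passes between open sets and prime divisors: effectivity at `P` spreads to a neighbourhood,
while membership in all stalks at prime divisors gives a section by saturation. -/
lemma IsSaturated.isDivisorOf_iff (hs : E.IsSaturated) {e : V} {D : WeilDivisor X} :
    IsDivisorOf (fun U hU ↦ (E.sections U hU : Set V)) e D ↔ E.HasMultiplicities e D := by
  constructor
  · intro H P f hf0
    rw [← coeffAt_div_add_nonneg_iff hf0]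
    constructor
    · rintro ⟨U, hU, hP, hv⟩
      exact (H U hU f).mpr hv P hP
    · intro h
      obtain ⟨U, hP, hU⟩ := exists_open_effectiveOn h
      exact ⟨U, genericPoint_mem_of_mem hP, hP, (H U _ f).mp hU⟩
  · intro H U hU f
    by_cases hf0 : f = 0
    · subst hf0
      rw [div_zero, zero_smul]
      exact iff_of_true (fun P _ ↦ by rw [WithTop.top_add]; exact le_top) (zero_mem _)
    constructor
    · intro h
      refine hs U hU _ fun P hP ↦ (H P f hf0).mpr ?_
      rw [← coeffAt_div_add_nonneg_iff hf0]
      exact h P hP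
    · intro h P hP
      rw [coeffAt_div_add_nonneg_iff hf0]
      exact (H P f hf0).mp (mem_stalkAt_of_mem_sections h hP)

variable [∀ x : X, IsIntegrallyClosed (X.presheaf.stalk x)]

lemma exists_multiplicity (h : E.IsLocallyGenerated) (hf : E.IsFull) {e : V} (he : e ≠ 0)
    (P : PrimeDivisor X) :
    ∃ m : ℤ, ∀ f : X.functionField, f ≠ 0 → (f • e ∈ E.stalkAt P.1 ↔ 0 ≤ Scheme.ord f P.1 + m) := by
  obtain ⟨c, hc, hce⟩ := exists_smul_mem_stalkAt h hf P.1 e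
  obtain ⟨l, hl⟩ := exists_dual_apply_eq_one (K := X.functionField) he
  -- A common denominator `b` for the values of `l` on local generators. As `l e = 1`, it forces
  -- `ord f ≥ -ord b` whenever `f • e` is in the stalk.
  have key : ∃ b : X.functionField, b ≠ 0 ∧ ∀ v ∈ E.stalkAt P.1, b * l v ∈ regularAt P.1 := by
    obtain ⟨U, hx, s, hs, H⟩ := h P.1
    obtain ⟨b, hb⟩ := IsLocalization.exist_integer_multiples_of_finset
      (nonZeroDivisors (regularAt P.1)) (hs.image l).toFinset
    refine ⟨b.1.1, fun h0 ↦ nonZeroDivisors.ne_zero b.2 (Subtype.ext h0), fun v hv ↦ ?_⟩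
    rw [H _ hx] at hv
    induction hv using Submodule.span_induction with
    | mem v hv =>
      obtain ⟨r, hr⟩ := hb (l v) (by simpa using ⟨v, hv, rfl⟩)
      have : b.1.1 * l v = r.1 := hr.symm
      rw [this]
      exact r.2
    | zero => rw [map_zero, mul_zero]; exact zero_mem _
    | add a b _ _ ha hb => rw [map_add, mul_add]; exact add_mem ha hb
    | smul r a _ ha =>
      rw [Subring.smul_def, map_smul, smul_eq_mul, mul_left_comm]
      exact mul_mem r.2 ha
  obtain ⟨b, hb, hbl⟩ := key
  -- The orders of the `f` with `f • e` in the stalk are bounded below and `c` is one such `f`. The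
  -- multiplicity is minus the least order, attained by `g`.
  obtain ⟨m, ⟨g, hg, rfl, hge⟩, hmin⟩ := Int.exists_least_of_bdd
    (P := fun n ↦ ∃ f : X.functionField, f ≠ 0 ∧ Scheme.ord f P.1 = n ∧ f • e ∈ E.stalkAt P.1)
    ⟨-Scheme.ord b P.1, fun n hn ↦ by
      obtain ⟨f, hf0, rfl, hfe⟩ := hn
      have h1 := hbl _ hfe
      rw [map_smul, hl, smul_eq_mul, mul_one,
        mem_regularAt_primeDivisor_iff P (mul_ne_zero hb hf0), Scheme.ord_mul hb hf0] at h1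
      omega⟩ ⟨_, c, hc, rfl, hce⟩
  refine ⟨-Scheme.ord g P.1, fun f hf0 ↦ ⟨fun hfe ↦ ?_, fun hle ↦ ?_⟩⟩
  · have := hmin _ ⟨f, hf0, rfl, hfe⟩
    omega
  · have h1 : f * g⁻¹ ∈ regularAt P.1 := by
      rw [mem_regularAt_primeDivisor_iff P (mul_ne_zero hf0 (inv_ne_zero hg)),
        Scheme.ord_mul hf0 (inv_ne_zero hg), ord_inv_add hg]
      exact hle
    have h2 := smul_mem_stalkAt h1 hge
    rwa [smul_smul, inv_mul_cancel_right₀ hg] at h2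

/-- Take `l` with `l e = 1`. Where `l` is a section of the dual and `e` one of `E`, `f • e` is in
the stalk exactly when `f` is regular. So multiplicities vanish outside finitely many prime
divisors. -/
lemma exists_hasMultiplicities (h : E.IsLocallyGenerated) (hf : E.IsFull) {e : V} (he : e ≠ 0) :
    ∃ D, E.HasMultiplicities e D := by
  choose m hm using exists_multiplicity h hf he
  obtain ⟨l, hl⟩ := exists_dual_apply_eq_one (K := X.functionField) he
  obtain ⟨U, hU, hlU⟩ := h.dual_isFull l
  obtain ⟨U', hU', heU⟩ := hf e
  have hfin : {P | m P ≠ 0}.Finite := by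
    refine (finite_primeDivisor_not_mem (U ⊓ U') ⟨hU, hU'⟩).subset fun P hP hPU ↦ hP ?_
    have key : ∀ f : X.functionField, f ≠ 0 → (0 ≤ Scheme.ord f P.1 ↔ 0 ≤ Scheme.ord f P.1 + m P) :=
      fun f hf0 ↦ by
        rw [← hm P f hf0, ← mem_regularAt_primeDivisor_iff P hf0]
        refine ⟨fun hfP ↦ smul_mem_stalkAt hfP (mem_stalkAt_of_mem_sections heU hPU.2), fun hfe ↦ ?_⟩
        have := hlU P.1 hPU.1 _ hfe
        rwa [map_smul, hl, smul_eq_mul, mul_one] at this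
    -- Order `0` yields `0 ≤ m P`, and order `-m P` yields `m P ≤ 0`.
    obtain ⟨f, hf0, h0⟩ := exists_ord_eq P 0
    obtain ⟨g, hg0, h1⟩ := exists_ord_eq P (-m P)
    have := key f hf0
    have := key g hg0
    omega
  exact ⟨Finsupp.ofSupportFinite m hfin, hm⟩

lemma HasMultiplicities.unique {e : V} {D D' : WeilDivisor X} (h : E.HasMultiplicities e D)
    (h' : E.HasMultiplicities e D') : D = D' := by
  ext P
  -- The two threshold orders give the two inequalities between `D P` and `D' P`.
  obtain ⟨f, hf0, hf⟩ := exists_ord_eq P (-D P)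
  obtain ⟨g, hg0, hg⟩ := exists_ord_eq P (-D' P)
  have h1 := (h P f hf0).symm.trans (h' P f hf0)
  have h2 := (h P g hg0).symm.trans (h' P g hg0)
  omega

lemma IsSaturated.existsUnique_isDivisorOf (hs : E.IsSaturated) (h : E.IsLocallyGenerated)
    (hf : E.IsFull) {e : V} (he : e ≠ 0) :
    ∃! D : WeilDivisor X, IsDivisorOf (fun U hU ↦ (E.sections U hU : Set V)) e D := by
  simp only [hs.isDivisorOf_iff]
  obtain ⟨D, hD⟩ := exists_hasMultiplicities h hf he
  exact ⟨D, hD, fun D' hD' ↦ hD'.unique hD⟩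

lemma IsSaturated.deco_eq (hs : E.IsSaturated) {e : V} (he : e ≠ 0) {D : WeilDivisor X}
    (hD : E.HasMultiplicities e D) : E.deco e = D := by
  have hex : ∃ D : WeilDivisor X, IsDivisorOf (fun U hU ↦ (E.sections U hU : Set V)) e D :=
    ⟨D, hs.isDivisorOf_iff.mpr hD⟩
  rw [deco, decorationOf, if_neg he, dif_pos hex]
  exact congrArg _ ((hs.isDivisorOf_iff.mp hex.choose_spec).unique hD)

lemma IsSaturated.effectiveOn_deco_iff (hs : E.IsSaturated) (h : E.IsLocallyGenerated)
    (hf : E.IsFull) {U : X.Opens} (hU : genericPoint X ∈ U) (e : V) :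
    EffectiveOn (E.deco e) U ↔ e ∈ E.sections U hU := by
  by_cases he : e = 0
  · subst he
    rw [deco_zero]
    exact iff_of_true (fun _ _ ↦ le_top) (zero_mem _)
  obtain ⟨D, hD⟩ := exists_hasMultiplicities h hf he
  rw [hs.deco_eq he hD]
  constructor
  · exact fun H ↦ hs U hU e fun P hP ↦ (hD.mem_stalkAt_iff P).mpr (WithTop.coe_le_coe.mp (H P hP))
  · exact fun H P hP ↦ WithTop.coe_le_coe.mpr
      ((hD.mem_stalkAt_iff P).mp (mem_stalkAt_of_mem_sections H hP))

lemma IsSaturated.isPreWeilDecoration_deco (hs : E.IsSaturated) (h : E.IsLocallyGenerated)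
    (hf : E.IsFull) : IsPreWeilDecoration E.deco where
  eq_top_iff v := by
    refine ⟨fun hv ↦ ?_, fun hv ↦ hv ▸ deco_zero⟩
    by_contra hv0
    obtain ⟨D, hD⟩ := exists_hasMultiplicities h hf hv0
    rw [hs.deco_eq hv0 hD] at hv
    exact WithTop.coe_ne_top hv
  smul f v := by
    by_cases hf0 : f = 0
    · rw [hf0, zero_smul, deco_zero, div_zero, WithTop.top_add]
    by_cases hv0 : v = 0
    · rw [hv0, smul_zero, deco_zero, WithTop.add_top]
    obtain ⟨D, hD⟩ := exists_hasMultiplicities h hf hv0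
    rw [hs.deco_eq hv0 hD, div, if_neg hf0, ← WithTop.coe_add]
    refine hs.deco_eq (smul_ne_zero hf0 hv0) fun P g hg0 ↦ ?_
    rw [smul_smul, hD P _ (mul_ne_zero hg0 hf0), Scheme.ord_mul hg0 hf0, add_assoc]
    rfl
  add v v' := by
    by_cases hv0 : v = 0
    · rw [hv0, zero_add]; exact inf_le_right
    by_cases hv0' : v' = 0
    · rw [hv0', add_zero]; exact inf_le_left
    by_cases hv'' : v + v' = 0
    · rw [hv'', deco_zero]; exact le_top
    obtain ⟨D, hD⟩ := exists_hasMultiplicities h hf hv0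
    obtain ⟨D', hD'⟩ := exists_hasMultiplicities h hf hv0'
    obtain ⟨D'', hD''⟩ := exists_hasMultiplicities h hf hv''
    rw [hs.deco_eq hv0 hD, hs.deco_eq hv0' hD', hs.deco_eq hv'' hD'', ← WithTop.coe_inf,
      WithTop.coe_le_coe]
    intro P
    -- This is the least order for which `f • v` and `f • v'` are both in the stalk; then so is
    -- their sum.
    obtain ⟨f, hf0, hfP⟩ := exists_ord_eq P (-(D P ⊓ D' P))
    have h1 : D P ⊓ D' P ≤ D P := inf_le_left
    have h2 : D P ⊓ D' P ≤ D' P := inf_le_right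
    have h3 := (hD'' P f hf0).mp (by
      rw [smul_add]
      exact add_mem ((hD P f hf0).mpr (by omega)) ((hD' P f hf0).mpr (by omega)))
    change D P ⊓ D' P ≤ D'' P
    omega

end Divisors

end ConstSubsheaf

/-! ### Decorations and saturated lattices recover each other -/

section Decorations

variable {X : Scheme.{u}} [IsIntegral X] [IsNoetherian X]
  {V : Type u} [AddCommGroup V] [Module X.functionField V] {W : V → WithTop (WeilDivisor X)}

lemma IsPreWeilDecoration.sheaf_isFull (h : IsPreWeilDecoration W) : h.sheaf.IsFull := fun v ↦
  let ⟨U, hU, hv⟩ := exists_open_genericPoint_effectiveOn (W v)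
  ⟨U, hU, hv⟩

/-- Effectivity on `U` is a condition at each prime divisor meeting `U`, so coherence plays no role.
-/
lemma IsPreWeilDecoration.sheaf_isSaturated (h : IsPreWeilDecoration W) : h.sheaf.IsSaturated := by
  intro U hU v H P hP
  obtain ⟨U', hU', hP', hv⟩ := H P hP
  exact hv P hP'

lemma IsPreWeilDecoration.isDivisorOf (h : IsPreWeilDecoration W) {v : V} {D : WeilDivisor X}
    (hD : W v = D) : IsDivisorOf (fun U hU ↦ (h.sheaf.sections U hU : Set V)) v D := by
  intro U hU f
  rw [← hD, ← h.smul]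
  rfl

/-- By the rule for `W (f • v)`, `W v` is a divisor of `v` with respect to the lattice, and such a
divisor is unique. -/
lemma IsPreWeilDecoration.deco_sheaf [∀ x : X, IsIntegrallyClosed (X.presheaf.stalk x)]
    (h : IsPreWeilDecoration W) : h.sheaf.deco = W := by
  funext v
  by_cases hv : v = 0
  · rw [hv, ConstSubsheaf.deco_zero, (h.eq_top_iff 0).mpr rfl]
  obtain ⟨D, hD⟩ := WithTop.ne_top_iff_exists.mp (mt (h.eq_top_iff v).mp hv)
  rw [← hD]
  exact h.sheaf_isSaturated.deco_eq hv
    (h.sheaf_isSaturated.isDivisorOf_iff.mp (h.isDivisorOf hD.symm))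

lemma ConstSubsheaf.IsSaturated.sheaf_deco [∀ x : X, IsIntegrallyClosed (X.presheaf.stalk x)]
    {E : ConstSubsheaf X V} (hs : E.IsSaturated) (h : E.IsLocallyGenerated) (hf : E.IsFull) :
    (hs.isPreWeilDecoration_deco h hf).sheaf = E := by
  ext U hU v
  exact hs.effectiveOn_deco_iff h hf hU v

end Decorations

/-! ### Presheaves of modules which embed into constant sheaves -/

lemma isIso_iff_bijective {X : Scheme.{u}}
    {M N : PresheafOfModules.{u} (X.presheaf ⋙ forget₂ CommRingCat RingCat)}
    (f : M ⟶ N) : IsIso f ↔ ∀ U : X.Opens, Function.Bijective (f.app (op U)) := by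
  rw [← isIso_iff_of_reflects_iso f (PresheafOfModules.toPresheaf _), NatTrans.isIso_iff_isIso_app]
  simp only [ConcreteCategory.isIso_iff_bijective]
  exact ⟨fun h U ↦ h (op U), fun h U ↦ h U.unop⟩

section Realization

variable {X : Scheme.{u}} [IsIntegral X] {V : Type u} [AddCommGroup V] [Module X.functionField V]

lemma subsingleton_sections_of_not_mem {U : X.Opens} (hU : genericPoint X ∉ U) :
    Subsingleton Γ(X, U) := by
  have : U = ⊥ := eq_bot_iff.mpr fun x hx ↦ hU (genericPoint_mem_of_mem hx)
  subst this
  infer_instance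

/-- An isomorphism of a presheaf of modules, on nonempty open sets, with a subsheaf of a constant
sheaf. -/
structure Realization (M : PresheafOfModules.{u} (X.presheaf ⋙ forget₂ CommRingCat RingCat))
    (S : ConstSubsheaf X V) where
  incl : ∀ U : X.Opens, genericPoint X ∈ U → (M.obj (op U) →+ V)
  injective : ∀ U hU, Function.Injective (incl U hU)
  mem_iff : ∀ U hU v, v ∈ S.sections U hU ↔ ∃ m, incl U hU m = v
  map_smul : ∀ (U : X.Opens) (hU : genericPoint X ∈ U) (f : X.presheaf.obj (op U))
    (m : M.obj (op U)), incl U hU (f • m) = X.presheaf.germ U _ hU f • incl U hU m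
  map_res : ∀ (U U' : X.Opens) (hU : genericPoint X ∈ U) (hU' : genericPoint X ∈ U') (h : U' ≤ U)
    (m : M.obj (op U)), incl U' hU' (M.map (homOfLE h).op m) = incl U hU m
  subsingleton : ∀ U : X.Opens, genericPoint X ∉ U → Subsingleton (M.obj (op U))

namespace Realization

open DualModule

variable {M : PresheafOfModules.{u} (X.presheaf ⋙ forget₂ CommRingCat RingCat)}
  {S : ConstSubsheaf X V} (ρ : Realization M S)

lemma incl_mem (U : X.Opens) (hU : genericPoint X ∈ U) (m : M.obj (op U)) :
    ρ.incl U hU m ∈ S.sections U hU := (ρ.mem_iff U hU _).mpr ⟨m, rfl⟩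

lemma exists_incl_eq (hf : S.IsFull) (U : X.Opens) (hU : genericPoint X ∈ U) (v : V) :
    ∃ (U' : X.Opens) (hU' : genericPoint X ∈ U') (_ : U' ≤ U) (m : M.obj (op U')),
      ρ.incl U' hU' m = v := by
  obtain ⟨U', hU', hv⟩ := hf v
  obtain ⟨m, hm⟩ := (ρ.mem_iff (U ⊓ U') ⟨hU, hU'⟩ v).mp (S.mono U' _ hU' _ inf_le_right hv)
  exact ⟨U ⊓ U', ⟨hU, hU'⟩, inf_le_left, m, hm⟩

lemma germ_dualEval_res {U : X.Opens} (φ : dualSections M U) {U₁ U₂ : X.Opens} (h₁ : U₁ ≤ U)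
    (h : U₂ ≤ U₁) (hU₁ : genericPoint X ∈ U₁) (hU₂ : genericPoint X ∈ U₂) (m : M.obj (op U₁)) :
    X.presheaf.germ U₂ _ hU₂ (dualEval φ U₂ (h.trans h₁) (M.map (homOfLE h).op m)) =
      X.presheaf.germ U₁ _ hU₁ (dualEval φ U₁ h₁ m) := by
  rw [← dualEval_res φ U₁ U₂ h₁ h]
  exact X.presheaf.germ_res_apply (homOfLE h) _ hU₂ _

/-- Makes `functional` well defined: sections representing the same vector agree over `U₁ ⊓ U₂`, so
their values have the same generic germ. -/
lemma germ_dualEval_eq {U : X.Opens} (φ : dualSections M U) {U₁ U₂ : X.Opens} (h₁ : U₁ ≤ U)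
    (h₂ : U₂ ≤ U) (hU₁ : genericPoint X ∈ U₁) (hU₂ : genericPoint X ∈ U₂) (m₁ : M.obj (op U₁))
    (m₂ : M.obj (op U₂)) (h : ρ.incl U₁ hU₁ m₁ = ρ.incl U₂ hU₂ m₂) :
    X.presheaf.germ U₁ _ hU₁ (dualEval φ U₁ h₁ m₁) =
      X.presheaf.germ U₂ _ hU₂ (dualEval φ U₂ h₂ m₂) := by
  have hU : genericPoint X ∈ U₁ ⊓ U₂ := ⟨hU₁, hU₂⟩
  rw [← germ_dualEval_res φ h₁ inf_le_left hU₁ hU m₁, ← germ_dualEval_res φ h₂ inf_le_right hU₂ hU m₂]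
  have : M.map (homOfLE (inf_le_left : U₁ ⊓ U₂ ≤ U₁)).op m₁ =
      M.map (homOfLE (inf_le_right : U₁ ⊓ U₂ ≤ U₂)).op m₂ := by
    apply ρ.injective _ hU
    rw [ρ.map_res _ _ hU₁, ρ.map_res _ _ hU₂, h]
  rw [this]

/-- The linear functional on `V` given by a section of the dual. -/
noncomputable def functional (hf : S.IsFull) {U : X.Opens} (hU : genericPoint X ∈ U)
    (φ : dualSections M U) : Module.Dual X.functionField V :=
  have key : ∀ v : V, ∃ k : X.functionField, ∀ (U' : X.Opens) (hU' : genericPoint X ∈ U')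
      (h : U' ≤ U) (m : M.obj (op U')), ρ.incl U' hU' m = v →
        X.presheaf.germ U' _ hU' (dualEval φ U' h m) = k := fun v ↦ by
    obtain ⟨U', hU', h, m, hm⟩ := ρ.exists_incl_eq hf U hU v
    exact ⟨_, fun U'' hU'' h' m' hm' ↦ ρ.germ_dualEval_eq φ h' h hU'' hU' m' m (hm'.trans hm.symm)⟩
  { toFun := fun v ↦ (key v).choose
    map_add' := fun v w ↦ by
      obtain ⟨U₁, hU₁, h₁, m₁, hm₁⟩ := ρ.exists_incl_eq hf U hU v
      obtain ⟨U₂, hU₂, h₂, n, hn⟩ := ρ.exists_incl_eq hf U₁ hU₁ w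
      obtain ⟨m, hm⟩ : ∃ m : M.obj (op U₂), ρ.incl U₂ hU₂ m = v :=
        ⟨_, (ρ.map_res U₁ U₂ hU₁ hU₂ h₂ m₁).trans hm₁⟩
      rw [← (key v).choose_spec U₂ hU₂ (h₂.trans h₁) m hm,
        ← (key w).choose_spec U₂ hU₂ (h₂.trans h₁) n hn, ← map_add, ← dualEval_add']
      refine ((key (v + w)).choose_spec U₂ hU₂ (h₂.trans h₁) _ ?_).symm
      rw [map_add, hm, hn]
    map_smul' := fun f v ↦ by
      obtain ⟨U₁, hU₁, g, rfl⟩ := X.presheaf.exists_germ_eq f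
      obtain ⟨U₂, hU₂, h₂, m, hm⟩ := ρ.exists_incl_eq hf (U ⊓ U₁) ⟨hU, hU₁⟩ v
      have hg : X.presheaf.germ U₂ _ hU₂ (X.presheaf.map (homOfLE (h₂.trans inf_le_right)).op g) =
        X.presheaf.germ U₁ _ hU₁ g := X.presheaf.germ_res_apply _ _ hU₂ g
      rw [← (key v).choose_spec U₂ hU₂ (h₂.trans inf_le_left) m hm, RingHom.id_apply, smul_eq_mul,
        ← hg, ← map_mul, ← dualEval_smul']
      refine ((key _).choose_spec U₂ hU₂ (h₂.trans inf_le_left) _ ?_).symm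
      rw [ρ.map_smul, hm] }

lemma functional_incl (hf : S.IsFull) {U : X.Opens} (hU : genericPoint X ∈ U)
    (φ : dualSections M U) {U' : X.Opens} (hU' : genericPoint X ∈ U') (h : U' ≤ U)
    (m : M.obj (op U')) :
    ρ.functional hf hU φ (ρ.incl U' hU' m) = X.presheaf.germ U' _ hU' (dualEval φ U' h m) := by
  obtain ⟨k, hk⟩ : ∃ k : X.functionField, k = ρ.functional hf hU φ (ρ.incl U' hU' m) := ⟨_, rfl⟩
  unfold functional at hk ⊢
  exact (Exists.choose_spec (p := fun k ↦ ∀ (U'' : X.Opens) (hU'' : genericPoint X ∈ U'')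
      (h : U'' ≤ U) (n : M.obj (op U'')), ρ.incl U'' hU'' n = ρ.incl U' hU' m →
        X.presheaf.germ U'' _ hU'' (dualEval φ U'' h n) = k) _ U' hU' h m rfl).symm

lemma functional_ext (hf : S.IsFull) {U : X.Opens} (hU : genericPoint X ∈ U)
    (φ : dualSections M U) {l : Module.Dual X.functionField V}
    (H : ∀ (U' : X.Opens) (hU' : genericPoint X ∈ U') (h : U' ≤ U) (m : M.obj (op U')),
      l (ρ.incl U' hU' m) = X.presheaf.germ U' _ hU' (dualEval φ U' h m)) :
    ρ.functional hf hU φ = l := by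
  ext v
  obtain ⟨U', hU', h, m, rfl⟩ := ρ.exists_incl_eq hf U hU v
  rw [ρ.functional_incl hf hU φ hU' h, H]

/-- Surjectivity onto the concrete dual: the values of `l` on sections are regular at every point,
hence come from sections of the structure sheaf. -/
lemma exists_functional_eq (hf : S.IsFull) {U : X.Opens} (hU : genericPoint X ∈ U)
    {l : Module.Dual X.functionField V} (hl : l ∈ S.dual.sections U hU) :
    ∃ φ : dualSections M U, ρ.functional hf hU φ = l := by
  classical
  have key : ∀ (U' : X.Opens) (_ : U' ≤ U) (hU' : genericPoint X ∈ U') (m : M.obj (op U')),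
      ∃ s : Γ(X, U'), X.presheaf.germ U' _ hU' s = l (ρ.incl U' hU' m) := fun U' h hU' m ↦ by
    have : l (ρ.incl U' hU' m) ∈ regularOn U' hU' := mem_regularOn_iff.mpr fun x hx ↦
      hl x (h hx) _ (ConstSubsheaf.mem_stalkAt_of_mem_sections (ρ.incl_mem U' hU' m) hx)
    exact this
  -- An open set without the generic point is empty and has the zero ring of functions, so the
  -- default value `0` is forced.
  let f : ∀ U' : X.Opens, U' ≤ U → M.obj (op U') → X.presheaf.obj (op U') := fun U' h m ↦
    if hU' : genericPoint X ∈ U' then (key U' h hU' m).choose else 0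
  have hfs : ∀ U' h hU' m, X.presheaf.germ U' _ hU' (f U' h m) = l (ρ.incl U' hU' m) :=
    fun U' h hU' m ↦ by
      simp only [f, dif_pos hU']
      exact (key U' h hU' m).choose_spec
  have hext : ∀ (U' : X.Opens) (s t : Γ(X, U')),
      (∀ hU', X.presheaf.germ U' _ hU' s = X.presheaf.germ U' _ hU' t) → s = t := fun U' s t H ↦ by
    by_cases hU' : genericPoint X ∈ U'
    · exact germ_injective_of_isIntegral X _ hU' (H hU')
    · have := subsingleton_sections_of_not_mem hU'
      exact Subsingleton.elim _ _
  refine ⟨dualMk f (fun U' h m n ↦ hext _ _ _ fun hU' ↦ ?_) (fun U' h r m ↦ hext _ _ _ fun hU' ↦ ?_)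
    (fun U₁ U₂ h₁ h m ↦ hext _ _ _ fun hU' ↦ ?_), ?_⟩
  · rw [map_add, hfs U' h hU', hfs U' h hU', hfs U' h hU', map_add, map_add]
  · rw [map_mul, hfs U' h hU', hfs U' h hU', ρ.map_smul, _root_.map_smul, smul_eq_mul]
  · refine (X.presheaf.germ_res_apply (homOfLE h) _ hU' _).trans ?_
    refine (hfs U₁ h₁ (h hU') m).trans (Eq.trans ?_ (hfs U₂ (h.trans h₁) hU' _).symm)
    exact congrArg l (ρ.map_res U₁ U₂ (h hU') hU' h m).symm
  · exact ρ.functional_ext hf hU _ fun U' hU' h m ↦ (hfs U' h hU' m).symm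

lemma dualSections_ext_of_germ {U : X.Opens} {φ ψ : dualSections M U}
    (H : ∀ (U' : X.Opens) (h : U' ≤ U) (hU' : genericPoint X ∈ U') (m : M.obj (op U')),
      X.presheaf.germ U' _ hU' (dualEval φ U' h m) = X.presheaf.germ U' _ hU' (dualEval ψ U' h m)) :
    φ = ψ := by
  refine dualSections_ext fun U' h m ↦ ?_
  by_cases hU' : genericPoint X ∈ U'
  · exact germ_injective_of_isIntegral X _ hU' (H U' h hU' m)
  · have := subsingleton_sections_of_not_mem hU'
    exact Subsingleton.elim (α := Γ(X, U')) _ _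

/-- The dual of a presheaf which embeds into a constant sheaf embeds into the dual sheaf. -/
noncomputable def dual (hf : S.IsFull) : Realization (DualModule.dual M) S.dual where
  incl U hU := AddMonoidHom.mk' (fun φ : dualSections M U ↦ ρ.functional hf hU φ) 
    fun (φ ψ : dualSections M U) ↦ ρ.functional_ext hf hU _ fun U' hU' h m ↦ by
      refine (congrArg₂ (· + ·) (ρ.functional_incl hf hU φ hU' h m)
        (ρ.functional_incl hf hU ψ hU' h m)).trans (map_add _ _ _).symm
  injective U hU φ ψ h := dualSections_ext_of_germ fun U' hle hU' m ↦ by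
    rw [← ρ.functional_incl hf hU φ hU' hle, ← ρ.functional_incl hf hU ψ hU' hle]
    exact congrArg (fun l : Module.Dual X.functionField V ↦ l (ρ.incl U' hU' m)) h
  mem_iff U hU l := by
    refine ⟨fun hl ↦ ρ.exists_functional_eq hf hU hl, ?_⟩
    rintro ⟨φ, rfl⟩ x hx v ⟨U', hU', hx', hv⟩
    obtain ⟨m, rfl⟩ := (ρ.mem_iff (U ⊓ U') ⟨hU, hU'⟩ v).mp (S.mono U' _ hU' _ inf_le_right hv)
    have := ρ.functional_incl hf hU φ (U' := U ⊓ U') ⟨hU, hU'⟩ inf_le_left m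
    change ρ.functional hf hU φ _ ∈ _
    rw [this]
    exact mem_regularAt_of_mem_regularOn (U := U ⊓ U') ⟨hx, hx'⟩ (germ_mem_regularOn _ _ _)
  map_smul U hU f (φ : dualSections M U) := ρ.functional_ext hf hU _ fun U' hU' h m ↦ by
    change X.presheaf.germ U _ hU f * ρ.functional hf hU φ _ = _
    rw [ρ.functional_incl hf hU φ hU' h]
    refine Eq.trans ?_ (congrArg _ (dualEval_smul (R := X.presheaf) f φ U' h m)).symm
    rw [map_mul]
    congr 1
    exact (X.presheaf.germ_res_apply (homOfLE h) _ hU' f).symm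
  map_res U U' hU hU' h (φ : dualSections M U) := ρ.functional_ext hf hU' _ fun U'' hU'' h' m ↦ by
    change ρ.functional hf hU φ _ = _
    rw [ρ.functional_incl hf hU φ hU'' (h'.trans h)]
    rfl
  subsingleton U hU := ⟨fun (φ ψ : dualSections M U) ↦ dualSections_ext_of_germ fun U' h hU' ↦
    absurd (h hU') hU⟩

/-- Identifies the canonical map with `V → V**`, so that reflexivity can be read off inside `V`. -/
lemma dual_incl_toBidual (hf : S.IsFull) (hd : S.dual.IsFull) (U : X.Opens)
    (hU : genericPoint X ∈ U) (m : M.obj (op U)) :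
    ((ρ.dual hf).dual hd).incl U hU ((toBidual M).app (op U) m) =
      Module.Dual.eval X.functionField V (ρ.incl U hU m) := by
  refine (ρ.dual hf).functional_ext hd hU _ fun U' hU' h φ ↦ ?_
  refine Eq.trans ?_ (ρ.functional_incl hf hU' φ hU' le_rfl (M.map (homOfLE h).op m))
  exact congrArg (ρ.functional hf hU' φ) (ρ.map_res U U' hU hU' h m).symm

/-- A presheaf of modules which embeds into a finite-dimensional constant sheaf as `S` is reflexive
if and only if `S` coincides with its double dual. -/
lemma isIso_toBidual_iff (ρ : Realization M S) [Module.Finite X.functionField V] (hf : S.IsFull) (hd : S.dual.IsFull) :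
    IsIso (toBidual M) ↔ ∀ U hU v,
      Module.Dual.eval X.functionField V v ∈ S.dual.dual.sections U hU → v ∈ S.sections U hU := by
  have hinj : Function.Injective (Module.Dual.eval X.functionField V) :=
    (Module.evalEquiv X.functionField V).injective
  rw [isIso_iff_bijective]
  constructor
  · intro H U hU v hv
    obtain ⟨t, ht⟩ := (((ρ.dual hf).dual hd).mem_iff U hU _).mp hv
    obtain ⟨m, rfl⟩ := (H U).2 t
    rw [ρ.dual_incl_toBidual hf hd] at ht
    rw [← hinj ht]
    exact ρ.incl_mem U hU m
  · intro H U
    by_cases hU : genericPoint X ∈ U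
    · refine ⟨fun m n h ↦ ρ.injective U hU (hinj ?_), fun t ↦ ?_⟩
      · rw [← ρ.dual_incl_toBidual hf hd, ← ρ.dual_incl_toBidual hf hd, h]
      -- Finite dimension turns the element of `V**` into evaluation at a vector `v`; the hypothesis
      -- makes `v` a section.
      · obtain ⟨v, hv⟩ := (Module.evalEquiv X.functionField V).surjective
          (((ρ.dual hf).dual hd).incl U hU t)
        have hv' : Module.Dual.eval X.functionField V v = ((ρ.dual hf).dual hd).incl U hU t := hv
        have hvU := H U hU v (hv' ▸ ((ρ.dual hf).dual hd).incl_mem U hU t)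
        obtain ⟨m, rfl⟩ := (ρ.mem_iff U hU v).mp hvU
        refine ⟨m, ((ρ.dual hf).dual hd).injective U hU ?_⟩
        rw [ρ.dual_incl_toBidual hf hd, hv']
    · have h1 := ρ.subsingleton U hU
      have h2 := ((ρ.dual hf).dual hd).subsingleton U hU
      exact ⟨fun _ _ _ ↦ Subsingleton.elim _ _, fun t ↦ ⟨0, Subsingleton.elim _ _⟩⟩

end Realization

end Realization

/-! ### Coherent sheaves which embed into constant sheaves -/

section Coherent

open DualModule

variable {X : Scheme.{u}} [IsIntegral X] {V : Type u} [AddCommGroup V] [Module X.functionField V]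

/-- The sheaf of modules of a subsheaf of a constant sheaf embeds into the constant sheaf. -/
noncomputable def ConstSubsheaf.realization (S : ConstSubsheaf X V) :
    Realization (X := X) S.toModules.val S where
  incl U hU := AddMonoidHom.mk' (fun s : S.gamma U ↦ s.1 ⟨hU⟩) fun _ _ ↦ rfl
  injective U hU s t h := Subtype.ext (funext fun _ ↦ h)
  mem_iff U hU v := ⟨fun hv ↦ ⟨(⟨fun _ ↦ v, fun _ ↦ hv⟩ : S.gamma U), rfl⟩, by
    rintro ⟨s, rfl⟩
    exact s.2 ⟨hU⟩⟩
  map_smul _ _ _ _ := rfl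
  map_res _ _ _ _ _ _ := rfl
  subsingleton U hU := ⟨fun (s t : S.gamma U) ↦ Subtype.ext (funext fun h ↦ absurd h.down hU)⟩

lemma genericGerm_res (E : X.Modules) {U U' : X.Opens} (hU : genericPoint X ∈ U)
    (hU' : genericPoint X ∈ U') (h : U' ≤ U) (s : Γ(E, U)) :
    genericGerm E U' hU' (E.presheaf.map (homOfLE h).op s) = genericGerm E U hU s :=
  TopCat.Presheaf.germ_res_apply E.presheaf (homOfLE h) _ hU' s

/-- The section vanishes on a smaller nonempty open set `W`, so every functional sends it to a
function vanishing on part of an integral scheme, hence to zero. -/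
lemma evalAt_eq_zero_of_genericGerm_eq_zero (E : X.Modules) {U : X.Opens} (hU : genericPoint X ∈ U)
    {s : Γ(E, U)} (hs : genericGerm E U hU s = 0) :
    evalAt (R := X.presheaf) (M := E.val) (U := U) s = 0 := by
  obtain ⟨W, hW, i, j, hWs⟩ := TopCat.Presheaf.germ_eq E.presheaf (genericPoint X) hU hU s 0
    (hs.trans (map_zero (genericGerm E U hU)).symm)
  rw [map_zero] at hWs
  refine dualSections_ext fun U' h φ ↦ ?_
  by_cases hU' : genericPoint X ∈ U'
  swap
  · have := subsingleton_sections_of_not_mem hU'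
    exact Subsingleton.elim (α := Γ(X, U')) _ _
  refine germ_injective_of_isIntegral X _ hU' ?_
  have key := Realization.germ_dualEval_res (X := X) (M := E.val) (U := U') φ le_rfl
    (inf_le_left : U' ⊓ W ≤ U') hU' ⟨hU', hW⟩ (E.presheaf.map (homOfLE h).op s)
  have h0 : E.presheaf.map (homOfLE (inf_le_left : U' ⊓ W ≤ U')).op
      (E.presheaf.map (homOfLE h).op s) = 0 := by
    have : E.presheaf.map (homOfLE (inf_le_right : U' ⊓ W ≤ W)).op (E.presheaf.map i.op s) = 0 := by
      rw [hWs, map_zero]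
    rw [← ConcreteCategory.comp_apply, ← Functor.map_comp] at this ⊢
    exact this
  refine key.symm.trans ?_
  refine (congrArg (fun m ↦ X.presheaf.germ _ _ (⟨hU', hW⟩ : genericPoint X ∈ U' ⊓ W)
    (dualEval (R := X.presheaf) (M := E.val) φ (U' ⊓ W) inf_le_left m)) h0).trans ?_
  have h1 : dualEval (R := X.presheaf) (M := E.val) φ (U' ⊓ W) inf_le_left 0 = 0 :=
    map_zero (φ.1 ⟨U' ⊓ W, inf_le_left⟩)
  refine (congrArg _ h1).trans ?_
  rw [map_zero]
  exact (map_zero _).symm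

lemma genericGerm_injective {E : X.Modules} (hE : IsIso (toBidual (R := X.presheaf) E.val))
    (U : X.Opens) (hU : genericPoint X ∈ U) : Function.Injective (genericGerm E U hU) := by
  refine (injective_iff_map_eq_zero _).mpr fun s hs ↦ ((isIso_iff_bijective (X := X) _).mp hE U).1 ?_
  exact (evalAt_eq_zero_of_genericGerm_eq_zero E hU hs).trans
    (map_zero ((toBidual (R := X.presheaf) E.val).app (op U)).hom).symm

/-- A sheaf of modules which embeds into its generic stalk, as a subsheaf of this stalk. -/
noncomputable def genericSubsheaf (E : X.Modules)
    (hE : ∀ U hU, Function.Injective (genericGerm E U hU)) : ConstSubsheaf X (GenericStalk E) where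
  sections U hU := (genericGerm E U hU).range
  smul_mem U hU f v := by
    rintro ⟨s, rfl⟩
    exact ⟨f • s, genericGerm_smul E U hU f s⟩
  mono U U' hU hU' h v := by
    rintro ⟨s, rfl⟩
    exact ⟨E.presheaf.map (homOfLE h).op s, genericGerm_res E hU hU' h s⟩
  locality U hU v h := exists_germ_eq_of_locally E.presheaf E.isSheaf (genericPoint X) hE U hU v h

lemma subsingleton_modules_of_not_mem (E : X.Modules) {U : X.Opens} (hU : genericPoint X ∉ U) :
    Subsingleton Γ(E, U) := by
  have := subsingleton_sections_of_not_mem hU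
  exact Module.subsingleton Γ(X, U) _

/-- The embedding of a sheaf of modules into its generic stalk. -/
noncomputable def genericRealization (E : X.Modules)
    (hE : ∀ U hU, Function.Injective (genericGerm E U hU)) :
    Realization (X := X) E.val (genericSubsheaf E hE) where
  incl U hU := genericGerm E U hU
  injective := hE
  mem_iff _ _ _ := Iff.rfl
  map_smul U hU f m := genericGerm_smul E U hU f m
  map_res _ _ hU hU' h m := genericGerm_res E hU hU' h m
  subsingleton _ hU := subsingleton_modules_of_not_mem E hU

lemma genericSubsheaf_isFull (E : X.Modules)
    (hE : ∀ U hU, Function.Injective (genericGerm E U hU)) : (genericSubsheaf E hE).IsFull :=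
  fun e ↦ by
    obtain ⟨U, hU, -, s, -, rfl⟩ := exists_genericGerm_eq E 0 e
    exact ⟨U, hU, s, rfl⟩

/-- Generators over an affine `U` generate the stalk at each `y ∈ U`: a vector there is a section
over some `D(a)` containing `y`, a power of `a` times it extends to `U`, and `a` is invertible at
`y`. -/
lemma Realization.isLocallyGenerated {E : X.Modules} {S : ConstSubsheaf X V}
    (ρ : Realization (X := X) E.val S) (hE : IsCoherent E) : S.IsLocallyGenerated := fun x ↦ by
  have := hE.1
  obtain ⟨_, ⟨U, hU, rfl⟩, hxU, -⟩ :=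
    X.isBasis_affineOpens.exists_subset_of_mem_open (Set.mem_univ x) isOpen_univ
  replace hU : IsAffineOpen U := hU
  have hηU : genericPoint X ∈ U := genericPoint_mem_of_mem hxU
  obtain ⟨⟨t, ht⟩⟩ := hE.2 ⟨U, hU⟩
  refine ⟨U, hxU, (fun m : Γ(E, U) ↦ ρ.incl U hηU m) '' (t : Set Γ(E, U)), t.finite_toSet.image _, fun y hy ↦ le_antisymm ?_ ?_⟩
  · rintro v ⟨U', hU', hyU', hv⟩
    obtain ⟨a, haU, hya⟩ := hU.exists_basicOpen_le ⟨y, hyU'⟩ hy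
    have hηa : genericPoint X ∈ X.basicOpen a := genericPoint_mem_of_mem hya
    obtain ⟨m, rfl⟩ := (ρ.mem_iff _ hηa v).mp (S.mono U' _ hU' hηa haU hv)
    obtain ⟨n, m', hm'⟩ := exists_extension_of_isQuasicoherent E hU a m
    obtain ⟨ha0, ha⟩ := inv_germ_mem_regularAt hηU a hya
    have h1 : ρ.incl U hηU m' = (X.presheaf.germ U _ hηU a) ^ n • ρ.incl _ hηa m := by
      rw [← ρ.map_res U _ hηU hηa (X.basicOpen_le a) m']
      refine (congrArg (ρ.incl _ hηa) hm').trans ((ρ.map_smul _ hηa _ m).trans ?_)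
      rw [← map_pow]
      congr 1
      exact X.presheaf.germ_res_apply (homOfLE (X.basicOpen_le a)) _ hηa (a ^ n)
    have h2 : ρ.incl _ hηa m = (X.presheaf.germ U _ hηU a)⁻¹ ^ n • ρ.incl U hηU m' := by
      rw [h1, smul_smul, ← mul_pow, inv_mul_cancel₀ ha0, one_pow, one_smul]
    rw [h2]
    refine Submodule.smul_mem _ (⟨_, pow_mem ha n⟩ : regularAt y) ?_
    have hm : m' ∈ Submodule.span Γ(X, U) (t : Set Γ(E, U)) := ht ▸ trivial
    clear hm' h1 h2
    induction hm using Submodule.span_induction with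
    | mem m hm => exact Submodule.subset_span ⟨m, hm, rfl⟩
    | zero => exact (map_zero (ρ.incl U hηU)).symm ▸ zero_mem _
    | add a b _ _ ha hb => exact (map_add (ρ.incl U hηU) a b).symm ▸ add_mem ha hb
    | smul r a _ ha =>
      refine (ρ.map_smul U hηU r a).symm ▸ ?_
      exact Submodule.smul_mem _ (⟨_, mem_regularAt_of_mem_regularOn hy
        (germ_mem_regularOn U hηU r)⟩ : regularAt y) ha
  · rw [Submodule.span_le]
    rintro _ ⟨m, -, rfl⟩
    exact ConstSubsheaf.mem_stalkAt_of_mem_sections (ρ.incl_mem U hηU m) hy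

variable [IsNoetherian X] [∀ x : X, IsIntegrallyClosed (X.presheaf.stalk x)]

/-- A coherent sheaf which embeds into a constant sheaf is reflexive if and only if its sections
are determined in codimension one. -/
lemma Realization.isReflexive_iff {E : X.Modules} {S : ConstSubsheaf X V}
    (ρ : Realization (X := X) E.val S) (hE : IsCoherent E) (hf : S.IsFull) :
    isReflexive X E ↔ S.IsSaturated := by
  have h := ρ.isLocallyGenerated hE
  have := ConstSubsheaf.finite_of_isLocallyGenerated h hf
  have hiff := ρ.isIso_toBidual_iff hf h.dual_isFull
  constructor
  · intro H
    exact ConstSubsheaf.isSaturated_of_forall_eval_mem (hiff.mp H.2)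
  · intro H
    exact ⟨hE, hiff.mpr fun U hU v hv ↦ H.mem_of_eval_mem h hf hv⟩

end Coherent

/-! ### The sheaf and the generic stalk of a realization -/

lemma IsCoherent.of_iso {X : Scheme.{u}} {E E' : X.Modules} (i : E ≅ E') (h : IsCoherent E) :
    IsCoherent E' := by
  refine ⟨(SheafOfModules.isQuasicoherent X.ringCatSheaf).prop_of_iso
    (X := (E : SheafOfModules X.ringCatSheaf)) (Y := (E' : SheafOfModules X.ringCatSheaf)) i h.1,
    fun U ↦ ?_⟩
  have := h.2 U
  let f : Γ(E, U.1) →ₗ[Γ(X, U.1)] Γ(E', U.1) :=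
    { (i.hom.app U.1).hom with map_smul' := fun r x ↦ i.hom.app_smul r x }
  refine Module.Finite.of_surjective f fun y ↦ ⟨i.inv.app U.1 y, ?_⟩
  have hi := congrArg (fun φ : E' ⟶ E' ↦ φ.app U.1) i.inv_hom_id
  exact congr($hi y)

namespace Realization

variable {X : Scheme.{u}} [IsIntegral X] {V : Type u} [AddCommGroup V] [Module X.functionField V]
  {E : X.Modules} {S : ConstSubsheaf X V} (ρ : Realization (X := X) E.val S)

/-- The morphism from a sheaf of modules to the subsheaf of a constant sheaf which realizes it. -/
noncomputable def toSubsheaf : E ⟶ S.toModules :=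
  SheafOfModules.Hom.mk <| PresheafOfModules.homMk
    { app := fun U ↦ AddCommGrpCat.ofHom (AddMonoidHom.mk'
        (fun s : E.val.obj (op U.unop) ↦ (⟨fun hU ↦ ρ.incl U.unop hU.down s,
          fun hU ↦ ρ.incl_mem _ _ _⟩ : S.gamma U.unop))
        fun _ _ ↦ Subtype.ext (funext fun _ ↦ map_add (ρ.incl _ _) _ _))
      naturality := fun U U' f ↦ by
        ext s
        exact Subtype.ext (funext fun hU : PLift (genericPoint X ∈ U'.unop) ↦
          ρ.map_res U.unop U'.unop (leOfHom f.unop hU.down) hU.down (leOfHom f.unop) s) }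
    fun U r s ↦ Subtype.ext (funext fun hU : PLift (genericPoint X ∈ U.unop) ↦
      ρ.map_smul U.unop hU.down r s)

instance : IsIso ρ.toSubsheaf := by
  rw [Scheme.Modules.Hom.isIso_iff_isIso_app]
  intro U
  rw [ConcreteCategory.isIso_iff_bijective]
  by_cases hU : genericPoint X ∈ U
  · refine ⟨fun s t h ↦ ρ.injective U hU ?_, fun (t : S.gamma U) ↦ ?_⟩
    · exact congrFun (congrArg Subtype.val h : (ρ.toSubsheaf.app U s : S.gamma U).1 =
        (ρ.toSubsheaf.app U t : S.gamma U).1) ⟨hU⟩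
    · obtain ⟨s, hs⟩ := (ρ.mem_iff U hU _).mp (t.2 ⟨hU⟩)
      exact ⟨s, Subtype.ext (funext fun _ ↦ hs)⟩
  · have h1 := ρ.subsingleton U hU
    have h2 := S.realization.subsingleton U hU
    exact ⟨fun s t _ ↦ h1.elim s t, fun t ↦ ⟨0, h2.elim _ _⟩⟩

/-- A sheaf of modules is isomorphic to the subsheaf of a constant sheaf which realizes it. -/
noncomputable def isoSubsheaf : E ≅ S.toModules := asIso ρ.toSubsheaf

lemma incl_eq_of_genericGerm_eq {U U' : X.Opens} (hU : genericPoint X ∈ U)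
    (hU' : genericPoint X ∈ U') {s : Γ(E, U)} {s' : Γ(E, U')}
    (h : genericGerm E U hU s = genericGerm E U' hU' s') : ρ.incl U hU s = ρ.incl U' hU' s' := by
  obtain ⟨W, hW, i, j, hij⟩ := TopCat.Presheaf.germ_eq E.presheaf (genericPoint X) hU hU' s s' h
  exact (ρ.map_res U W hU hW (leOfHom i) s).symm.trans
    ((congrArg (ρ.incl W hW) hij).trans (ρ.map_res U' W hU' hW (leOfHom j) s'))

lemma exists_eq_incl (e : GenericStalk E) : ∃ v : V, ∀ (U : X.Opens) (hU : genericPoint X ∈ U)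
    (s : Γ(E, U)), genericGerm E U hU s = e → ρ.incl U hU s = v := by
  obtain ⟨U, hU, -, s, -, rfl⟩ := exists_genericGerm_eq E 0 e
  exact ⟨_, fun U' hU' s' h ↦ ρ.incl_eq_of_genericGerm_eq hU' hU h⟩

/-- The map from the generic stalk of a sheaf of modules to a vector space which realizes it. -/
noncomputable def stalkMap : GenericStalk E →ₗ[X.functionField] V where
  toFun e := (ρ.exists_eq_incl e).choose
  map_add' e e' := by
    obtain ⟨U, hU, -, s, -, rfl⟩ := exists_genericGerm_eq E 0 e
    obtain ⟨U', hU', -, s', -, rfl⟩ := exists_genericGerm_eq E 0 e'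
    have hW : genericPoint X ∈ U ⊓ U' := ⟨hU, hU'⟩
    rw [← genericGerm_res E hU hW inf_le_left, ← genericGerm_res E hU' hW inf_le_right,
      ← (ρ.exists_eq_incl _).choose_spec _ hW _ rfl,
      ← (ρ.exists_eq_incl (genericGerm E _ hW _)).choose_spec _ hW _ rfl,
      ← (ρ.exists_eq_incl _).choose_spec _ hW _ (map_add _ _ _)]
    exact map_add (ρ.incl _ hW) _ _
  map_smul' f e := by
    obtain ⟨U, hU, g, s, rfl, rfl⟩ := exists_genericGerm_eq E f e
    rw [← (ρ.exists_eq_incl (genericGerm E U hU s)).choose_spec U hU s rfl,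
      ← (ρ.exists_eq_incl _).choose_spec U hU (g • s) (genericGerm_smul E U hU g s)]
    exact ρ.map_smul U hU g s

lemma stalkMap_genericGerm (U : X.Opens) (hU : genericPoint X ∈ U) (s : Γ(E, U)) :
    ρ.stalkMap (genericGerm E U hU s) = ρ.incl U hU s :=
  ((ρ.exists_eq_incl _).choose_spec U hU s rfl).symm

lemma stalkMap_injective : Function.Injective ρ.stalkMap := by
  refine (injective_iff_map_eq_zero _).mpr fun e he ↦ ?_
  obtain ⟨U, hU, -, s, -, rfl⟩ := exists_genericGerm_eq E 0 e
  rw [stalkMap_genericGerm] at he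
  have : s = 0 := ρ.injective U hU (he.trans (map_zero (ρ.incl U hU)).symm)
  rw [this, map_zero]

lemma mem_genericImage_iff {U : X.Opens} {hU : genericPoint X ∈ U} {e : GenericStalk E} :
    e ∈ genericImage E U hU ↔ ρ.stalkMap e ∈ S.sections U hU := by
  constructor
  · rintro ⟨s, rfl⟩
    rw [stalkMap_genericGerm]
    exact ρ.incl_mem U hU s
  · intro h
    obtain ⟨s, hs⟩ := (ρ.mem_iff U hU _).mp h
    exact ⟨s, ρ.stalkMap_injective ((ρ.stalkMap_genericGerm U hU s).trans hs)⟩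

/-- The generic stalk of a sheaf of modules is the vector space which realizes it. -/
noncomputable def stalkEquiv (hf : S.IsFull) : GenericStalk E ≃ₗ[X.functionField] V :=
  LinearEquiv.ofBijective ρ.stalkMap ⟨ρ.stalkMap_injective, fun v ↦ by
    obtain ⟨U, hU, hv⟩ := hf v
    obtain ⟨s, rfl⟩ := (ρ.mem_iff U hU v).mp hv
    exact ⟨_, ρ.stalkMap_genericGerm U hU s⟩⟩

/-- Allows decorations to be compared along a linear injection without knowing that a divisor
exists. -/
lemma decorationOf_congr [IsNoetherian X] {V' : Type u} [AddCommGroup V']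
    [Module X.functionField V'] {A : ∀ U : X.Opens, genericPoint X ∈ U → Set V}
    {A' : ∀ U : X.Opens, genericPoint X ∈ U → Set V'} {e : V} {e' : V'} (h0 : e = 0 ↔ e' = 0)
    (h : ∀ U hU, ∀ f : X.functionField, f • e ∈ A U hU ↔ f • e' ∈ A' U hU) :
    decorationOf A e = decorationOf A' e' := by
  -- Equality of the predicates, rather than equivalence, identifies the chosen divisors as well as
  -- the default cases.
  have key : IsDivisorOf A e = IsDivisorOf A' e' := by
    funext D
    unfold IsDivisorOf
    simp only [h]
  unfold decorationOf
  generalize IsDivisorOf A e = p at key ⊢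
  subst key
  by_cases he : e = 0
  · rw [if_pos he, if_pos (h0.mp he)]
  · rw [if_neg he, if_neg (mt h0.mpr he)]

lemma decorationOfSheaf_eq [IsNoetherian X] (e : GenericStalk E) :
    decorationOfSheaf E e = S.deco (ρ.stalkMap e) := by
  refine decorationOf_congr (map_eq_zero_iff _ ρ.stalkMap_injective).symm fun U hU f ↦ ?_
  rw [ρ.mem_genericImage_iff, _root_.map_smul]
  rfl

end Realization

/-! ### Reflexive sheaves and Weil decorations -/

lemma ReflexiveSheafOn.isLocallyGenerated {X : Scheme.{u}} [IsIntegral X] {V : Type u}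
    [AddCommGroup V] [Module X.functionField V] (E : ReflexiveSheafOn X V) : E.1.IsLocallyGenerated :=
  E.1.realization.isLocallyGenerated E.2.1.1

section Main

variable {X : Scheme.{u}} [IsIntegral X] [IsNoetherian X]

/-- The embedding of the sheaf of a Weil decoration into the constant sheaf. -/
noncomputable abbrev WeilDeco.realization (W : WeilDeco X) :
    Realization (X := X) W.sheaf.val W.isWeilDecoration.sheaf :=
  W.isWeilDecoration.sheaf.realization

/-- Naturality of the identification of the generic stalk of `𝒪_X(W)` with the space of `W`. -/
lemma WeilDeco.stalkMap_genericStalkMap {W W' : WeilDeco X} (μ : W ⟶ W')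
    (e : GenericStalk W.sheaf) :
    W'.realization.stalkMap (genericStalkMap (sheafMap μ) e) =
      WeilDeco.Hom.linearMap μ (W.realization.stalkMap e) := by
  obtain ⟨U, hU, -, s, -, rfl⟩ := exists_genericGerm_eq W.sheaf 0 e
  rw [genericStalkMap_germ, Realization.stalkMap_genericGerm, Realization.stalkMap_genericGerm]
  rfl

/-- Weil decorations which correspond under a linear equivalence are isomorphic. -/
noncomputable def WeilDeco.isoMk (W W' : WeilDeco X)
    (l : W.space ≃ₗ[X.functionField] W'.space) (hl : ∀ e, W.deco e = W'.deco (l e)) : W ≅ W' where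
  hom := ⟨l.toLinearMap, fun e ↦ (hl e).le⟩
  inv := ⟨l.symm.toLinearMap, fun v ↦ by
    have := hl (l.symm v)
    rw [l.apply_symm_apply] at this
    exact this.ge⟩
  hom_inv_id := WeilDeco.Hom.ext (LinearMap.ext l.symm_apply_apply)
  inv_hom_id := WeilDeco.Hom.ext (LinearMap.ext l.apply_symm_apply)

variable [∀ x : X, IsIntegrallyClosed (X.presheaf.stalk x)]
  {V V' : Type u} [AddCommGroup V] [Module X.functionField V] [AddCommGroup V']
  [Module X.functionField V']

lemma ConstSubsheaf.IsSaturated.deco_le {S : ConstSubsheaf X V} {S' : ConstSubsheaf X V'}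
    (hs : S.IsSaturated) (h : S.IsLocallyGenerated) (hf : S.IsFull) (hs' : S'.IsSaturated)
    (h' : S'.IsLocallyGenerated) (hf' : S'.IsFull) (μ : V →ₗ[X.functionField] V')
    (hμ : ∀ U hU, ∀ v ∈ S.sections U hU, μ v ∈ S'.sections U hU) (v : V) :
    S.deco v ≤ S'.deco (μ v) := by
  by_cases hv' : μ v = 0
  · rw [hv', deco_zero]
    exact le_top
  have hv : v ≠ 0 := fun h0 ↦ hv' (by rw [h0, map_zero])
  obtain ⟨D, hD⟩ := exists_hasMultiplicities h hf hv
  obtain ⟨D', hD'⟩ := exists_hasMultiplicities h' hf' hv'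
  rw [hs.deco_eq hv hD, hs'.deco_eq hv' hD', WithTop.coe_le_coe]
  intro P
  -- With `ord f = -D P` the vector `f • v` is just in the stalk of `S`; its image `f • μ v` lies in
  -- that of `S'`, so `D P ≤ D' P`.
  obtain ⟨f, hf0, hfP⟩ := exists_ord_eq P (-D P)
  obtain ⟨U, hU, hP, hfv⟩ := (hD P f hf0).mpr (by omega)
  have := (hD' P f hf0).mp ⟨U, hU, hP, map_smul μ f v ▸ hμ U hU _ hfv⟩
  omega

/-- The properties of a reflexive sheaf, as a subsheaf of its generic stalk. -/
lemma isReflexive.generic {E : X.Modules} (hE : isReflexive X E) :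
    (genericSubsheaf E (genericGerm_injective hE.2)).IsSaturated ∧
    (genericSubsheaf E (genericGerm_injective hE.2)).IsLocallyGenerated ∧
    (genericSubsheaf E (genericGerm_injective hE.2)).IsFull :=
  have ρ := genericRealization E (genericGerm_injective hE.2)
  have hf := genericSubsheaf_isFull E (genericGerm_injective hE.2)
  ⟨(ρ.isReflexive_iff hE.1 hf).mp hE, ρ.isLocallyGenerated hE.1, hf⟩

lemma isReflexive.finite {E : X.Modules} (hE : isReflexive X E) :
    Module.Finite X.functionField (GenericStalk E) :=
  ConstSubsheaf.finite_of_isLocallyGenerated hE.generic.2.1 hE.generic.2.2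

lemma isReflexive.isPreWeilDecoration {E : X.Modules} (hE : isReflexive X E) :
    IsPreWeilDecoration (decorationOfSheaf E) :=
  hE.generic.1.isPreWeilDecoration_deco hE.generic.2.1 hE.generic.2.2

lemma isReflexive.sheaf_decorationOfSheaf {E : X.Modules} (hE : isReflexive X E) :
    hE.isPreWeilDecoration.sheaf = genericSubsheaf E (genericGerm_injective hE.2) :=
  hE.generic.1.sheaf_deco hE.generic.2.1 hE.generic.2.2

/-- The embedding of a reflexive sheaf into its generic stalk. -/
noncomputable def isReflexive.realization {E : X.Modules} (hE : isReflexive X E) :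
    Realization (X := X) E.val hE.isPreWeilDecoration.sheaf :=
  { genericRealization E (genericGerm_injective hE.2) with
    mem_iff := fun U hU v ↦ by
      rw [hE.sheaf_decorationOfSheaf]
      exact (genericRealization E (genericGerm_injective hE.2)).mem_iff U hU v }

/-- Coherence is inherited from `E` along the isomorphism of `E` with `𝒪_X(W_E)`. -/
lemma isReflexive.isWeilDecoration {E : X.Modules} (hE : isReflexive X E) :
    IsWeilDecoration (decorationOfSheaf E) :=
  { hE.isPreWeilDecoration with isCoherent := hE.1.of_iso (hE.realization.isoSubsheaf) }

lemma isReflexive.decorationOfSheaf_le {E E' : X.Modules} (hE : isReflexive X E)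
    (hE' : isReflexive X E') (φ : E ⟶ E') (e : GenericStalk E) :
    decorationOfSheaf E e ≤ decorationOfSheaf E' (genericStalkMap φ e) := by
  refine hE.generic.1.deco_le hE.generic.2.1 hE.generic.2.2 hE'.generic.1 hE'.generic.2.1
    hE'.generic.2.2 (genericStalkMap φ) ?_ e
  rintro U hU _ ⟨s, rfl⟩
  exact ⟨_, (genericStalkMap_germ φ U hU s).symm⟩

lemma ConstSubsheaf.isReflexive_iff {S : ConstSubsheaf X V} (hf : S.IsFull) :
    isReflexive X S.toModules ↔ IsCoherent S.toModules ∧ S.IsSaturated :=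
  ⟨fun h ↦ ⟨h.1, (S.realization.isReflexive_iff h.1 hf).mp h⟩,
    fun h ↦ (S.realization.isReflexive_iff h.1 hf).mpr h.2⟩

/-- Saturation is automatic, so coherence is all that has to be assumed. -/
lemma IsWeilDecoration.isReflexive_sheaf {W : V → WithTop (WeilDivisor X)}
    (h : IsWeilDecoration W) : isReflexive X h.toIsPreWeilDecoration.sheaf.toModules :=
  (ConstSubsheaf.isReflexive_iff h.sheaf_isFull).mpr ⟨h.isCoherent, h.sheaf_isSaturated⟩

lemma ReflexiveSheafOn.isSaturated (E : ReflexiveSheafOn X V) : E.1.IsSaturated :=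
  ((ConstSubsheaf.isReflexive_iff E.2.2).mp E.2.1).2

/-- On a fixed vector space, Weil decorations correspond to reflexive subsheaves of the constant
sheaf. -/
noncomputable def weilDecorationEquiv : WeilDecorationOn X V ≃ ReflexiveSheafOn X V where
  toFun W := ⟨W.2.toIsPreWeilDecoration.sheaf, W.2.isReflexive_sheaf,
    W.2.toIsPreWeilDecoration.sheaf_isFull⟩
  invFun E := ⟨E.1.deco,
    { ReflexiveSheafOn.isSaturated E |>.isPreWeilDecoration_deco
        (ReflexiveSheafOn.isLocallyGenerated E) E.2.2 with
      isCoherent := by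
        have := (ReflexiveSheafOn.isSaturated E).sheaf_deco
          (ReflexiveSheafOn.isLocallyGenerated E) E.2.2
        rw [this]
        exact E.2.1.1 }⟩
  left_inv W := Subtype.ext W.2.deco_sheaf
  right_inv E := Subtype.ext ((ReflexiveSheafOn.isSaturated E).sheaf_deco
    (ReflexiveSheafOn.isLocallyGenerated E) E.2.2)

lemma WeilDeco.decorationOfSheaf_sheaf (W : WeilDeco X) (e : GenericStalk W.sheaf) :
    decorationOfSheaf W.sheaf e = W.deco (W.realization.stalkMap e) := by
  rw [W.realization.decorationOfSheaf_eq, W.isWeilDecoration.deco_sheaf]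

variable (X)

/-- The equivalence between Weil decorations and reflexive sheaves. -/
noncomputable def weilDecoEquivalence (hF : ∀ W : WeilDeco X, isReflexive X W.sheaf)
    (hfin : ∀ E : RefShe X, Module.Finite X.functionField (GenericStalk E.obj))
    (hG : ∀ E : RefShe X, IsWeilDecoration (decorationOfSheaf E.obj))
    (hmap : ∀ (E E' : RefShe X) (φ : E ⟶ E') (e : GenericStalk E.obj),
      decorationOfSheaf E.obj e ≤ decorationOfSheaf E'.obj (genericStalkMap φ.hom e)) :
    WeilDeco X ≌ RefShe X :=
  -- This constructor keeps both functors and only adjusts the unit to satisfy the triangle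
  -- identity, so the functors are recovered by `rfl`.
  .mk (sheafFunctor hF) (decorationFunctor hfin hG hmap)
    (NatIso.ofComponents (F := sheafFunctor hF ⋙ decorationFunctor hfin hG hmap) (G := 𝟭 _)
      -- The generic stalk of `𝒪_X(W)` is the original space, and the decoration read off there is
      -- `W`.
      (fun W ↦ WeilDeco.isoMk _ W (W.realization.stalkEquiv W.isWeilDecoration.sheaf_isFull)
        W.decorationOfSheaf_sheaf)
      (fun μ ↦ WeilDeco.Hom.ext (LinearMap.ext (WeilDeco.stalkMap_genericStalkMap μ)))).symm
    (NatIso.ofComponents (F := 𝟭 _) (G := decorationFunctor hfin hG hmap ⋙ sheafFunctor hF)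
      (fun E ↦ (isReflexive X).isoMk (isReflexive.realization E.2).isoSubsheaf)
      -- Naturality is checked on sections, where `E → 𝒪_X(W_E)` takes generic germs and `φ_η` is
      -- compatible with them.
      (fun {E E'} φ ↦ ObjectProperty.hom_ext _ (Scheme.Modules.hom_ext _ _ fun U ↦ by
        ext s
        exact Subtype.ext (funext fun hU : PLift (genericPoint X ∈ U) ↦
          (genericStalkMap_germ φ.hom U hU.down s).symm)))).symm

end Main

end WeilDecorations

theorem theoremA {k : Type u} [Field k] [IsAlgClosed k] [CharZero k] (X : NormalVariety k) :
    -- For a fixed vector space `V`, the maps `W ↦ 𝒪_X(W)` and `E ↦ W_E` are well defined and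
    -- mutually inverse.
    (∀ (V : Type u) [AddCommGroup V] [Module X.toScheme.functionField V]
        [Module.Finite X.toScheme.functionField V],
      (∀ (E : ReflexiveSheafOn X.toScheme V) (e : V), e ≠ 0 →
        ∃! D : WeilDivisor X.toScheme, IsDivisorOf (fun U hU ↦ (E.1.sections U hU : Set V)) e D) ∧
      ∃ σ : WeilDecorationOn X.toScheme V ≃ ReflexiveSheafOn X.toScheme V,
        (∀ W : WeilDecorationOn X.toScheme V, (σ W).1 = W.2.toIsPreWeilDecoration.sheaf) ∧
        (∀ E : ReflexiveSheafOn X.toScheme V,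
          (σ.symm E).1 = decorationOf (fun U hU ↦ (E.1.sections U hU : Set V)))) ∧
    -- Every reflexive sheaf `E` embeds into its generic stalk, the map `W_E` is well defined, and
    -- `𝒪_X(W_E) = E` as subsheaves of the constant sheaf `E_η`.
    (∀ E : X.toScheme.Modules, isReflexive X.toScheme E →
      (∀ U hU, Function.Injective (genericGerm E U hU)) ∧
      (∀ e : GenericStalk E, e ≠ 0 →
        ∃! D : WeilDivisor X.toScheme, IsDivisorOf (genericImage E) e D) ∧
      (∀ U hU, genericImage E U hU = {e | EffectiveOn (decorationOfSheaf E e) U})) ∧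
    -- The functors `W ↦ 𝒪_X(W)` and `E ↦ W_E`, `φ ↦ φ_η` are well defined and are mutually
    -- quasi-inverse equivalences of categories.
    ∃ (hF : ∀ W : WeilDeco X.toScheme, isReflexive X.toScheme W.sheaf)
      (hfin : ∀ E : RefShe X.toScheme,
        Module.Finite X.toScheme.functionField (GenericStalk E.obj))
      (hG : ∀ E : RefShe X.toScheme, IsWeilDecoration (decorationOfSheaf E.obj))
      (hmap : ∀ (E E' : RefShe X.toScheme) (φ : E ⟶ E') (e : GenericStalk E.obj),
        decorationOfSheaf E.obj e ≤ decorationOfSheaf E'.obj (genericStalkMap φ.hom e))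
      (equiv : WeilDeco X.toScheme ≌ RefShe X.toScheme),
      equiv.functor = sheafFunctor hF ∧ equiv.inverse = decorationFunctor hfin hG hmap := by
  refine ⟨fun V _ _ _ ↦ ⟨fun E e he ↦ ?_, weilDecorationEquiv, fun _ ↦ rfl, fun _ ↦ rfl⟩,
    fun E hE ↦ ⟨genericGerm_injective hE.2, fun e he ↦ ?_, fun U hU ↦ ?_⟩,
    fun W ↦ W.isWeilDecoration.isReflexive_sheaf, fun E ↦ isReflexive.finite E.2,
    fun E ↦ isReflexive.isWeilDecoration E.2,
    fun E E' φ ↦ isReflexive.decorationOfSheaf_le E.2 E'.2 φ.hom,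
    weilDecoEquivalence _ _ _ _ _, rfl, rfl⟩
  · exact (ReflexiveSheafOn.isSaturated E).existsUnique_isDivisorOf
      (ReflexiveSheafOn.isLocallyGenerated E) E.2.2 he
  · exact hE.generic.1.existsUnique_isDivisorOf hE.generic.2.1 hE.generic.2.2 he
  · ext e
    exact (hE.generic.1.effectiveOn_deco_iff hE.generic.2.1 hE.generic.2.2 hU e).symm
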